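/- **Theorem 10.1 (quantum curve).** Let $P,Q$ be integers with $Q\ge 1$ and put $b=P/Q$ (for the torus knot $T[Q,P]$ the integers $P,Q$ are coprime). Let $A$ be a nonzero complex number with a chosen logarithm, so that $A^r=e^{r\log A}$ for $r\in\mathbb{Q}$, and let $\hbar$ be a formal variable. Let $\alpha_n=\sum_{k\in\mathbb{Z}+1/2}E_{k-n,k}$ $(n\ne0)$ and $\mathcal F_2=\sum_{k\in\mathbb{Z}+1/2}\frac{k^2}{2}E_{k,k}$ be the operators on the semi-infinite wedge space built from the normally ordered products $E_{ij}={:}\psi_i\psi_j^*{:}$, let $\langle\,\cdot\,\rangle$ be the vacuum expectation value, and let $$Z^{ext}(p,\bar p)=\Big\langle \exp\Big(\sum_{i\ge1}\frac{\alpha_i p_i}{i}\Big)\exp(\hbar b\,\mathcal F_2)\exp\Big(\sum_{j\ge1}\frac{\alpha_{-j}\,\bar p_{j/Q}\,Q\,A^{jb}}{j}\Big)\Big\rangle$$ be the extended Ooguri–Vafa partition function, a formal power series in $\bar p_{1/Q},\bar p_{2/Q},\dots$. Let $\Psi(\Lambda)\in\mathbb{C}((\hbar))[[\Lambda]]$ be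 its principal specialization on the topological locus: put $p_i=p_i^*=\dfrac{A^i-A^{-i}}{e^{\hbar i/2}-e^{-\hbar i/2}}$ and $\bar p_{i/Q}=Q^{-1}\Lambda^i$, and then replace $\hbar$ by $-\hbar$. Let $D=\Lambda\frac{d}{d\Lambda}$. Then: 1. $\displaystyle\Psi(\Lambda)=\sum_{\ell\ge0}\Lambda^\ell A^{\ell b}\,e^{-\hbar b\frac{\ell^2-\ell}{2}}\prod_{i=1}^{\ell}\frac{Ae^{-\hbar(i-1)/2}-A^{-1}e^{\hbar(i-1)/2}}{e^{-\hbar i/2}-e^{\hbar i/2}}.$ 2. $\displaystyle\Big[\big(e^{-\frac\hbar2D}-e^{\frac\hbar2D}\big)-\Lambda A^b e^{-\hbar bD}\big(Ae^{-\frac\hbar2D}-A^{-1}e^{\frac\hbar2D}\big)\Big]\Psi=0.$ 3. The operator in 2 can be written as a finite sum $\sum c_{j,r}\Lambda^je^{r\hbar D}$ with $c_{j,r}\in\mathbb{C}$, $j\in\mathbb{Z}_{\ge0}$, $r\in\mathbb{Q}$, and its dequantization $\sigma=\sum c_{j,r}\Lambda^jV^r$, where $\Lambda=e^\lambda$ and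 $V=e^v$ (so that $\Lambda^jV^r=e^{j\lambda+rv}$), is a well-defined function of $(\lambda,v)\in\mathbb{C}^2$. Suppose $A^2\neq1$. Then $\sigma(\lambda,v)=0$ if and only if $1-A^{-2}V\ne0$ and $$\Lambda=\frac{1-V}{A^{b+1}V^{-b}(1-A^{-2}V)} .$$ This is the Brini–Eynard–Mariño curve: for all integers $\gamma,\delta$ with $Q\delta-P\gamma=1$, a point $(x,y)\in\mathbb{C}^2$ lies on the curve $$x=Q\log U+P\log(1-A^{b+1}U)-P\log(1-A^{b-1}U),\qquad y=\frac{\gamma}{Q}x+\frac1Q\log(1-A^{b+1}U)-\frac1Q\log(1-A^{b-1}U)$$ for some $U$ and some branches of the three logarithms (the same branches in $x$ and $y$) if and only if $\sigma(\lambda,v)=0$ for $\lambda=x/Q$ and $v=Qy-\gamma x$. -/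

import Mathlib

/-! The semi-infinite wedge space, the extended Ooguri-Vafa partition function of the torus knot
`T[Q,P]`, its wave function, difference operators and their dequantization, and the
Brini-Eynard-Mariño curve.

Conventions: `K = ℂ((ħ))`; `b = P/Q`; the parameter `A` is given by a logarithm `a`, that is,
`A = exp a` and `A ^ r = exp (r a)` for rational `r`. -/

noncomputable section

namespace TorusQSC

/-! ### Laurent series in `ħ` -/

/-- The field `ℂ((ħ))`. -/
def K : Type := LaurentSeries ℂ

instance : Field K := inferInstanceAs (Field (LaurentSeries ℂ))

/-- The coefficient of `ħ ^ n`. -/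
def K.coeff (f : K) (n : ℤ) : ℂ := HahnSeries.coeff (Γ := ℤ) (R := ℂ) f n

/-- `e^{c ħ}` as an element of `ℂ((ħ))`. -/
def expH (c : ℂ) : K :=
  show LaurentSeries ℂ from HahnSeries.ofPowerSeries ℤ ℂ (PowerSeries.rescale c (PowerSeries.exp ℂ))

/-- A complex constant as an element of `ℂ((ħ))`. -/
def const (c : ℂ) : K := show LaurentSeries ℂ from HahnSeries.C c

/-- `e^{c ħ}` is the sum of its exponential series, coefficient by coefficient in `ħ`. -/
theorem coeff_expH_mul (c : ℂ) (g : K) (n : ℤ) :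
    (expH c * g).coeff n = ∑ᶠ m : ℕ, c ^ m / (m.factorial : ℂ) * g.coeff (n - m) := by
  let e : LaurentSeries ℂ :=
    HahnSeries.ofPowerSeries ℤ ℂ (PowerSeries.rescale c (PowerSeries.exp ℂ))
  let g' : LaurentSeries ℂ := g
  have he : ∀ m : ℕ, e.coeff (m : ℤ) = c ^ m / (m.factorial : ℂ) := by
    intro m
    have := HahnSeries.ofPowerSeries_apply_coeff (Γ := ℤ)
      (PowerSeries.rescale c (PowerSeries.exp ℂ)) m
    simp [e, PowerSeries.coeff_exp, div_eq_mul_inv] at this ⊢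
  have he' : ∀ i : ℤ, i < 0 → e.coeff i = 0 := by
    intro i hi
    apply HahnSeries.embDomain_of_notMem_range
    rintro ⟨m, hm⟩
    simp at hm
    omega
  change (e * g').coeff n = ∑ᶠ m : ℕ, c ^ m / (m.factorial : ℂ) * g'.coeff (n - m)
  have h2 : (∑ᶠ m : ℕ, c ^ m / (m.factorial : ℂ) * g'.coeff (n - m)) =
      ∑ᶠ i : ℤ, e.coeff i * g'.coeff (n - i) := by
    simp only [← he]
    rw [← finsum_mem_range (f := fun i : ℤ => e.coeff i * g'.coeff (n - i))
      (g := fun m : ℕ => (m : ℤ)) Nat.cast_injective]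
    refine finsum_congr fun i => ?_
    by_cases hi : i ∈ Set.range (fun m : ℕ => (m : ℤ))
    · simp only [hi, finsum_true]
    · have : e.coeff i = 0 := he' i (by
        by_contra h
        exact hi ⟨i.toNat, by simp; omega⟩)
      simp [this]
  rw [h2, HahnSeries.coeff_mul]
  have h3 : (Function.support fun i : ℤ => e.coeff i * g'.coeff (n - i)) ⊆
      ((Finset.antidiagonal e.isPWO_support g'.isPWO_support n).image Prod.fst : Finset ℤ) := by
    intro i hi
    simp only [Function.mem_support, ne_eq, mul_eq_zero, not_or] at hi
    simp only [Finset.coe_image, Set.mem_image, Finset.mem_coe, Finset.mem_antidiagonal]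
    exact ⟨(i, n - i), ⟨hi.1, hi.2, by simp⟩, rfl⟩
  rw [finsum_eq_sum_of_support_subset _ h3, Finset.sum_image]
  · refine Finset.sum_congr rfl ?_
    rintro ⟨i, j⟩ hij
    rw [Finset.mem_antidiagonal] at hij
    have : n - i = j := by have := hij.2.2; simp at this; omega
    simp [this]
  · rintro ⟨i, j⟩ hij ⟨i', j'⟩ hij' h
    simp only [Finset.mem_coe, Finset.mem_antidiagonal] at hij hij'
    have h1 := hij.2.2
    have h2 := hij'.2.2
    simp at h h1 h2 ⊢
    omega

/-- `ζ(c ħ) = e^{c ħ / 2} - e^{- c ħ / 2}`. -/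
def zetaH (c : ℂ) : K := expH (c / 2) - expH (-c / 2)

/-- The substitution `ħ ↦ -ħ` on Laurent series. -/
def negLaurent : LaurentSeries ℂ →+* LaurentSeries ℂ where
  toFun f :=
    { coeff := fun n => ((n.negOnePow : ℤ) : ℂ) * f.coeff n
      isPWO_support' := f.isPWO_support.mono (by
        intro n hn
        simp only [Function.mem_support, HahnSeries.mem_support] at hn ⊢
        exact right_ne_zero_of_mul hn) }
  map_one' := by
    ext n
    by_cases h : n = 0 <;> simp [HahnSeries.coeff_one, h]
  map_zero' := by ext n; simp
  map_add' f g := by ext n; simp [mul_add]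
  map_mul' f g := by
    ext n
    have hs : ∀ f : LaurentSeries ℂ, ∀ h,
        (HahnSeries.mk (fun n => ((n.negOnePow : ℤ) : ℂ) * f.coeff n) h : LaurentSeries ℂ).support = f.support := by
      intro f h
      ext n
      simp
    rw [HahnSeries.coeff_mul]
    simp only [hs, HahnSeries.coeff_mul, Finset.mul_sum]
    refine Finset.sum_congr rfl ?_
    rintro ⟨i, j⟩ hij
    rw [Finset.mem_antidiagonal] at hij
    rw [← hij.2.2, Int.negOnePow_add]
    push_cast
    ring

/-- The substitution `ħ ↦ -ħ`, an endomorphism of the field `ℂ((ħ))`. -/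
def negH : K →+* K := negLaurent

/-- `A ^ r`, for `A = exp a`. -/
def Apow (a : ℂ) (r : ℚ) : ℂ := Complex.exp (r * a)

/-- `b = P / Q`. -/
def slope (P : ℤ) (Q : ℕ) : ℚ := (P : ℚ) / Q

/-! ### The semi-infinite wedge space

The integer `n` stands for the half-integer `n + 1/2`. A semi-infinite wedge product
`i₁ ∧ i₂ ∧ ⋯` of decreasing half-integers, with `i_k + k` eventually constant, is recorded by the
set of its factors. -/

/-- The labels of the basis vectors of the semi-infinite wedge space. -/
@[ext] structure Maya where
  /-- the set of wedge factors -/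
  occ : Set ℤ
  finite_pos : {n | 0 ≤ n ∧ n ∈ occ}.Finite
  finite_neg : {n | n < 0 ∧ n ∉ occ}.Finite

namespace Maya

/-- The vacuum `-1/2 ∧ -3/2 ∧ ⋯`. -/
def vacuum : Maya where
  occ := {n | n < 0}
  finite_pos := by
    convert Set.finite_empty (α := ℤ)
    ext n
    simp
  finite_neg := by
    convert Set.finite_empty (α := ℤ)
    ext n
    simp

/-- Add the factor `k`. -/
def add (S : Maya) (k : ℤ) : Maya where
  occ := insert k S.occ
  finite_pos := (S.finite_pos.insert k).subset (by
    rintro n ⟨h0, h | h⟩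
    · exact Or.inl h
    · exact Or.inr ⟨h0, h⟩)
  finite_neg := S.finite_neg.subset (by
    rintro n ⟨h0, h⟩
    exact ⟨h0, fun h' => h (Or.inr h')⟩)

/-- Remove the factor `k`. -/
def remove (S : Maya) (k : ℤ) : Maya where
  occ := S.occ \ {k}
  finite_pos := S.finite_pos.subset (by
    rintro n ⟨h0, h⟩
    exact ⟨h0, h.1⟩)
  finite_neg := (S.finite_neg.insert k).subset (by
    rintro n ⟨h0, h⟩
    by_cases hk : n = k
    · exact Or.inl hk
    · exact Or.inr ⟨h0, fun h' => h ⟨h', hk⟩⟩)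

/-- The sign of moving the factor `k` past all the factors larger than `k`. -/
def sign (S : Maya) (k : ℤ) : ℤ := (-1) ^ {n | n ∈ S.occ ∧ k < n}.ncard

end Maya

section Operators

variable (k : Type) [Field k]

/-- The semi-infinite wedge space over the field `k`. -/
abbrev Wedge : Type := Maya →₀ k

/-- The basis vector labelled by `S`. -/
def basisVec (S : Maya) : Wedge k := Finsupp.single S 1

variable {k}

/-- The operator with prescribed values on the basis. -/
def ofBasis (f : Maya → Wedge k) : Module.End k (Wedge k) := Finsupp.linearCombination k f

variable (k)

open Classical in
/-- `ψ_i`: exterior multiplication by the vector `i` on the left. -/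
def psi (i : ℤ) : Module.End k (Wedge k) :=
  ofBasis fun S => if i ∈ S.occ then 0 else S.sign i • basisVec k (S.add i)

open Classical in
/-- `ψ_i^*`: the adjoint of `ψ_i`. -/
def psiStar (i : ℤ) : Module.End k (Wedge k) :=
  ofBasis fun S => if i ∈ S.occ then S.sign i • basisVec k (S.remove i) else 0

/-- The normally ordered product `E_{ij} = :ψ_i ψ_j^*:`. -/
def EOp (i j : ℤ) : Module.End k (Wedge k) :=
  if 0 ≤ j then psi k i * psiStar k j else -(psiStar k j * psi k i)

/-- `α_n = ∑_j E_{j-n,j}` for `n ≠ 0`; the sum is finite on every basis vector. -/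
def alpha (n : ℤ) : Module.End k (Wedge k) :=
  ofBasis fun S => ∑ᶠ j : ℤ, EOp k (j - n) j (basisVec k S)

/-- `F₂ = ∑_j (j² / 2) E_{j,j}`, over half-integers `j`; the sum is finite on every basis vector. -/
def F2 : Module.End k (Wedge k) :=
  ofBasis fun S => ∑ᶠ j : ℤ, (((j : k) + 1 / 2) ^ 2 / 2) • EOp k j j (basisVec k S)

variable {k}

/-- `∑_{i ≥ 1} α_i p_i / i`; the sum is finite on every basis vector. -/
def currentPlus (p : ℕ+ → k) : Module.End k (Wedge k) :=
  ofBasis fun S => ∑ᶠ i : ℕ+, (p i / ((i : ℕ) : k)) • alpha k (i : ℕ) (basisVec k S)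

/-- `exp (∑_{i ≥ 1} α_i p_i / i)`; the exponential series is finite on every basis vector, since
`α_i` lowers the energy for `i > 0`. -/
def GammaPlus (p : ℕ+ → k) : Module.End k (Wedge k) :=
  ofBasis fun S => ∑ᶠ n : ℕ, ((n.factorial : k)⁻¹) • (currentPlus p ^ n) (basisVec k S)

variable (k)

/-- Formal power series with coefficients in the wedge space, in variables `X_j` indexed by
positive integers: a monomial is sent to its coefficient. -/
abbrev WedgeSeries : Type := (ℕ+ →₀ ℕ) → Wedge k

/-- The series in which only the constant term is nonzero, and equal to the vacuum vector. -/
def vacSeries : WedgeSeries k := Pi.single 0 (basisVec k Maya.vacuum)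

variable {k}

/-- `∑_{j ≥ 1} α_{-j} p̃_j / j`, where `p̃_j = t_j X_j`. -/
def currentMinus (t : ℕ+ → k) (F : WedgeSeries k) : WedgeSeries k := fun m =>
  ∑ j ∈ m.support, (t j / ((j : ℕ) : k)) •
    alpha k (-((j : ℕ) : ℤ)) (F (m - Finsupp.single j 1))

/-- `exp (∑_{j ≥ 1} α_{-j} p̃_j / j)`, where `p̃_j = t_j X_j`; the exponential series is finite for
each monomial. -/
def GammaMinus (t : ℕ+ → k) (F : WedgeSeries k) : WedgeSeries k := fun m =>
  ∑ᶠ n : ℕ, ((n.factorial : k)⁻¹) • ((currentMinus t)^[n] F) m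

end Operators

/-- The eigenvalue of `F₂` on the basis vector labelled by `S`, a rational number. -/
def F2eig (S : Maya) : ℚ := F2 ℚ (basisVec ℚ S) S

theorem EOp_self (S : Maya) (j : ℤ) :
    ∃ c : ℚ, EOp ℚ j j (basisVec ℚ S) = c • basisVec ℚ S := by
  by_cases h : j ∈ S.occ
  · have h1 : (S.remove j).add j = S := by ext n; simp [Maya.add, Maya.remove]; grind
    have h2 : j ∉ (S.remove j).occ := by simp [Maya.remove]
    by_cases hj : 0 ≤ j
    · exact ⟨S.sign j * (S.remove j).sign j, by
        simp [EOp, hj, psi, psiStar, ofBasis, h, h2, h1, basisVec]⟩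
    · exact ⟨0, by simp [EOp, hj, psi, psiStar, ofBasis, h, basisVec]⟩
  · have h1 : (S.add j).remove j = S := by ext n; simp [Maya.add, Maya.remove]; grind
    have h2 : j ∈ (S.add j).occ := by simp [Maya.add]
    by_cases hj : 0 ≤ j
    · exact ⟨0, by simp [EOp, hj, psi, psiStar, ofBasis, h, basisVec]⟩
    · exact ⟨-(S.sign j * (S.add j).sign j), by
        simp [EOp, hj, psi, psiStar, ofBasis, h, h2, h1, basisVec]⟩

/-- `F₂` is diagonal in the basis. -/
theorem F2_basisVec (S : Maya) : F2 ℚ (basisVec ℚ S) = F2eig S • basisVec ℚ S := by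
  choose c hc using EOp_self S
  have h : F2 ℚ (basisVec ℚ S) =
      (∑ᶠ j : ℤ, (((j : ℚ) + 1 / 2) ^ 2 / 2) * c j) • basisVec ℚ S := by
    rw [finsum_smul]
    simp only [F2, ofBasis, basisVec, Finsupp.linearCombination_single, one_smul] at hc ⊢
    refine finsum_congr fun j => ?_
    rw [hc, mul_smul]
  rw [F2eig, h]
  simp [basisVec]

/-- `exp (c ħ F₂)`, the operator `F₂` being diagonal in the basis. -/
def expF2 (c : ℚ) : Module.End K (Wedge K) :=
  ofBasis fun S => expH ((c * F2eig S : ℚ) : ℂ) • basisVec K S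

/-! ### The extended Ooguri-Vafa partition function -/

/-- The extended Ooguri-Vafa partition function
`⟨0| exp (∑ α_i p_i / i) exp (ħ (P/Q) F₂) exp (∑ α_{-j} p̃_j / j) |0⟩`, where
`p̃_j = p̄_{j/Q} Q A^{j P / Q}`: a formal power series, whose variable with index `j` is
`p̄_{j/Q}`. -/
def Zext (P : ℤ) (Q : ℕ) (a : ℂ) (p : ℕ+ → K) : MvPowerSeries ℕ+ K := fun m =>
  GammaPlus p (expF2 (slope P Q)
    (GammaMinus (fun j => (Q : K) * const (Apow a ((j : ℕ) * slope P Q))) (vacSeries K) m))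
    Maya.vacuum

/-- The topological locus `p^*_i = (A^i - A^{-i}) / (e^{ħ i / 2} - e^{- ħ i / 2})`. -/
def pStar (a : ℂ) (i : ℕ+) : K :=
  const (Apow a (i : ℕ) - Apow a (-(i : ℕ))) / zetaH (i : ℕ)

/-- The principal specialization `p̄_{i/Q} = Q⁻¹ Λ^i`. -/
def principal (Q : ℕ) (i : ℕ+) : PowerSeries K :=
  PowerSeries.C ((Q : K)⁻¹) * PowerSeries.X ^ (i : ℕ)

/-- The principal specialization may be substituted into formal power series. -/
theorem principal_hasSubst (Q : ℕ) : MvPowerSeries.HasSubst (principal Q) := by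
  constructor
  · intro i
    have : MvPowerSeries.constantCoeff (principal Q i) = 0 := by
      change PowerSeries.constantCoeff (principal Q i) = 0
      simp [principal]
    simp [this]
  · intro d
    refine Set.Finite.subset (Set.finite_Iic ((d ()).succPNat : ℕ+)) ?_
    intro (i : ℕ+) hi
    by_contra h
    apply hi
    have hd : d = Finsupp.single () (d ()) := by ext; simp
    rw [hd]
    change PowerSeries.coeff (d ()) (principal Q i) = 0
    have : d () ≠ (i : ℕ) := by
      intro h'
      apply h
      rw [Set.mem_Iic, ← PNat.coe_le_coe]
      simp only [Nat.succPNat_coe]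
      omega
    rw [principal, PowerSeries.coeff_C_mul, PowerSeries.coeff_X_pow, if_neg this, mul_zero]

/-- The wave function `Ψ(Λ)`: the principal specialization of the extended partition function on
the topological locus, with `ħ` replaced by `-ħ`. -/
def Psi (P : ℤ) (Q : ℕ) (a : ℂ) : PowerSeries K :=
  PowerSeries.map negH (MvPowerSeries.subst (principal Q) (Zext P Q a (pStar a)) : PowerSeries K)

/-! ### Difference operators in `Λ` -/

/-- The operator `D = Λ d/dΛ`. -/
def eulerD : Module.End K (PowerSeries K) where
  toFun f := PowerSeries.X * PowerSeries.derivative K f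
  map_add' f g := by simp [mul_add]
  map_smul' r f := by simp

theorem coeff_eulerD_pow (n l : ℕ) (f : PowerSeries K) :
    PowerSeries.coeff l ((eulerD ^ n) f) = (l : K) ^ n * PowerSeries.coeff l f := by
  have h1 : ∀ g : PowerSeries K, PowerSeries.coeff l (eulerD g) = l * PowerSeries.coeff l g := by
    intro g
    change PowerSeries.coeff l (PowerSeries.X * PowerSeries.derivative K g) = _
    cases l with
    | zero => simp
    | succ l =>
      rw [PowerSeries.coeff_succ_X_mul, PowerSeries.coeff_derivative]
      push_cast
      ring
  induction n with
  | zero => simp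
  | succ n ih => rw [pow_succ', Module.End.mul_apply, h1, ih]; ring

/-- `e^{c ħ D}` with `D = Λ d/dΛ`; it multiplies `Λ^l` by `e^{c ħ l}`. -/
def expD (c : ℂ) : Module.End K (PowerSeries K) where
  toFun f := PowerSeries.mk fun l => expH (c * l) * PowerSeries.coeff l f
  map_add' f g := by ext l; simp [mul_add]
  map_smul' r f := by ext1 l; simp [mul_left_comm]

/-- `e^{c ħ D}` is the sum of the exponential series `∑ (c ħ D)^m / m!`, coefficient by coefficient
in `Λ` and `ħ`. -/
theorem coeff_expD (c : ℂ) (f : PowerSeries K) (l : ℕ) (n : ℤ) :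
    (PowerSeries.coeff l (expD c f)).coeff n =
      ∑ᶠ m : ℕ, c ^ m / (m.factorial : ℂ) *
        (PowerSeries.coeff l ((eulerD ^ m) f)).coeff (n - m) := by
  have h : ∀ (r : ℕ) (g : K) (i : ℤ), ((r : K) * g).coeff i = r * g.coeff i := by
    intro r g i
    rw [← nsmul_eq_mul, ← nsmul_eq_mul]
    exact map_nsmul (HahnSeries.coeff.addMonoidHom (R := ℂ) i) r (show LaurentSeries ℂ from g)
  have h0 : PowerSeries.coeff l (expD c f) = expH (c * l) * PowerSeries.coeff l f := by
    simp [expD]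
  rw [h0, coeff_expH_mul]
  refine finsum_congr fun m => ?_
  rw [coeff_eulerD_pow, ← Nat.cast_pow, h, mul_pow]
  push_cast
  ring

/-- Multiplication by `Λ`. -/
def mulLam : Module.End K (PowerSeries K) := LinearMap.mulLeft K PowerSeries.X

/-- `(e^{-ħD/2} - e^{ħD/2}) - Λ A^b e^{-ħbD} (A e^{-ħD/2} - A⁻¹ e^{ħD/2})`. -/
def quantumCurve (P : ℤ) (Q : ℕ) (a : ℂ) : Module.End K (PowerSeries K) :=
  (expD (-1 / 2) - expD (1 / 2)) -
    mulLam * (const (Apow a (slope P Q)) • expD (-(slope P Q : ℂ))) *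
      (const (Apow a 1) • expD (-1 / 2) - const (Apow a (-1)) • expD (1 / 2))

/-- Normally ordered expressions `∑ c_{j,r} Λ^j e^{r ħ D}`, recorded by their coefficients. -/
abbrev DiffExpr : Type := (ℕ × ℚ) →₀ ℂ

/-- The operator `∑ c_{j,r} Λ^j e^{r ħ D}`. -/
def DiffExpr.toOp (S : DiffExpr) : Module.End K (PowerSeries K) :=
  S.sum fun jr c => const c • (mulLam ^ jr.1 * expD (jr.2 : ℂ))

/-- The function `∑ c_{j,r} Λ^j V^r` on the `(λ, v)`-plane, where `Λ = e^λ` and `V = e^v`. -/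
def DiffExpr.symbol (S : DiffExpr) (lam v : ℂ) : ℂ :=
  S.sum fun jr c => c * Complex.exp (jr.1 * lam) * Complex.exp (jr.2 * v)

/-- `σ` is the dequantization of the operator `L`: write `L = ∑ c_{j,r} Λ^j e^{r ħ D}` and replace
`e^{ħ D}` by `V`. -/
def IsDequantization (L : Module.End K (PowerSeries K)) (σ : ℂ → ℂ → ℂ) : Prop :=
  ∃ S : DiffExpr, S.toOp = L ∧ σ = S.symbol

/-! ### The Brini-Eynard-Mariño curve -/

/-- The set of values `(x, y)` on the curve
`x = Q log U + P log (1 - A^{b+1} U) - P log (1 - A^{b-1} U)`,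
`y = (γ / Q) x + (1 / Q) log (1 - A^{b+1} U) - (1 / Q) log (1 - A^{b-1} U)`,
for all branches `l`, `lp`, `lm` of the three logarithms. -/
def BEMCurve (P : ℤ) (Q : ℕ) (a : ℂ) (γ : ℤ) : Set (ℂ × ℂ) :=
  {xy | ∃ U l lp lm : ℂ,
    Complex.exp l = U ∧
    Complex.exp lp = 1 - Apow a (slope P Q + 1) * U ∧
    Complex.exp lm = 1 - Apow a (slope P Q - 1) * U ∧
    xy.1 = Q * l + P * lp - P * lm ∧
    xy.2 = γ / Q * xy.1 + lp / Q - lm / Q}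

end TorusQSC

end

/-! At the principal specialization the creation exponential applied to the vacuum involves only the
one-row vectors `rowVec l`: the coefficient of `Λ^l` is `A^{bl} • rowVec l`. Indeed the coefficients
of the exponential of a commuting current obey the Newton recursion `l f_l = ∑ T_j f_{l-j}`
(`smul_currentExp`), and so do the one-row vectors (`sum_alpha_neg_rowVec`). The latter is
fermionic: `rowVec l` is `ψ_{l-1}` applied to the charge `-1` vacuum, the commutator of `α_{-i}`
with it raises the row, and the remaining terms cancel in pairs by antisymmetry.

On `rowVec l` the operator `F₂` has eigenvalue `(l² - l)/2`, and the vacuum coefficient of the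
annihilation exponential is the complete homogeneous function `h_l(p)`. On the topological locus,
the generating series `H` of the `h_l` satisfies `(1 - AX) H(qX) = (1 - A⁻¹X) H(q⁻¹X)` with `q =
e^{ħ/2}`, because both sides have the same logarithmic derivative and constant term. This is a
two-term recursion (`q_recursion`). It gives the product formula after `ħ ↦ -ħ`, and the quantum
curve is the same recursion written as an operator.

Dequantization is well defined because `toOp` is injective: applied to the monomials `Λ^l`, an
expression yields combinations of the characters `l ↦ e^{rħl}` of `ℕ`, and distinct characters are
linearly independent. The explicit symbol is then matched with the Brini-Eynard-Mariño curve by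
setting `U = Λ V^{-b}`; `A² ≠ 1` excludes the points where both logarithms would be singular. -/

noncomputable section

namespace TorusQSC

/-! ### Signs under adding and removing wedge factors. -/

namespace Maya

theorem finite_above (S : Maya) (k : ℤ) : {n | n ∈ S.occ ∧ k < n}.Finite := by
  refine (S.finite_pos.union (Set.finite_Ioo k 0)).subset ?_
  rintro n ⟨h, hk⟩
  by_cases h0 : 0 ≤ n
  · exact Or.inl ⟨h0, h⟩
  · exact Or.inr ⟨hk, by omega⟩

theorem mem_add {S : Maya} {k n : ℤ} : n ∈ (S.add k).occ ↔ n = k ∨ n ∈ S.occ := Iff.rfl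

theorem mem_remove {S : Maya} {k n : ℤ} : n ∈ (S.remove k).occ ↔ n ∈ S.occ ∧ n ≠ k := Iff.rfl

theorem sign_mul_self (S : Maya) (k : ℤ) : S.sign k * S.sign k = 1 := by
  rw [sign, ← mul_pow]; simp

/-- The new factor is counted among those above `i` exactly when `i < k`; this flip is the source of
all the anticommutation signs. -/
theorem sign_add {S : Maya} {k : ℤ} (hk : k ∉ S.occ) (i : ℤ) :
    (S.add k).sign i = if i < k then -S.sign i else S.sign i := by
  unfold sign
  split_ifs with h
  · have : {n | n ∈ (S.add k).occ ∧ i < n} = insert k {n | n ∈ S.occ ∧ i < n} := by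
      ext n
      simp only [mem_add, Set.mem_ofPred_eq, Set.mem_insert_iff]
      grind
    rw [this, Set.ncard_insert_of_notMem (by simp [hk]) (S.finite_above i), pow_succ]
    ring
  · have : {n | n ∈ (S.add k).occ ∧ i < n} = {n | n ∈ S.occ ∧ i < n} := by
      ext n
      simp only [mem_add, Set.mem_ofPred_eq]
      grind
    rw [this]

theorem remove_add {S : Maya} {k : ℤ} (hk : k ∈ S.occ) : (S.remove k).add k = S := by
  ext n; simp only [mem_add, mem_remove]; grind

theorem add_remove {S : Maya} {k : ℤ} (hk : k ∉ S.occ) : (S.add k).remove k = S := by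
  ext n; simp only [mem_add, mem_remove]; grind

theorem notMem_remove (S : Maya) (k : ℤ) : k ∉ (S.remove k).occ := by simp [mem_remove]

theorem sign_remove {S : Maya} {k : ℤ} (hk : k ∈ S.occ) (i : ℤ) :
    (S.remove k).sign i = if i < k then -S.sign i else S.sign i := by
  have h := sign_add (S.notMem_remove k) i
  rw [remove_add hk] at h
  split_ifs at h ⊢ <;> simp [h]

theorem add_comm (S : Maya) (i j : ℤ) : (S.add i).add j = (S.add j).add i := by
  ext n; simp only [mem_add]; tauto

theorem add_remove_comm (S : Maya) {i j : ℤ} (h : i ≠ j) :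
    (S.add i).remove j = (S.remove j).add i := by
  ext n; simp only [mem_add, mem_remove]; grind

theorem remove_comm (S : Maya) (i j : ℤ) : (S.remove i).remove j = (S.remove j).remove i := by
  ext n; simp only [mem_remove]; tauto

end Maya

/-! ### Canonical anticommutation relations. -/

section Fermions

variable {k : Type} [Field k]

theorem ofBasis_basisVec (f : Maya → Wedge k) (S : Maya) : ofBasis f (basisVec k S) = f S := by
  simp [ofBasis, basisVec]

theorem end_ext {f g : Module.End k (Wedge k)}
    (h : ∀ S, f (basisVec k S) = g (basisVec k S)) : f = g :=
  Finsupp.lhom_ext' fun S => LinearMap.ext_ring (h S)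

theorem psi_of_mem {i : ℤ} {S : Maya} (h : i ∈ S.occ) : psi k i (basisVec k S) = 0 := by
  simp [psi, ofBasis_basisVec, h]

theorem psi_of_notMem {i : ℤ} {S : Maya} (h : i ∉ S.occ) :
    psi k i (basisVec k S) = S.sign i • basisVec k (S.add i) := by
  simp [psi, ofBasis_basisVec, h]

theorem psiStar_of_mem {i : ℤ} {S : Maya} (h : i ∈ S.occ) :
    psiStar k i (basisVec k S) = S.sign i • basisVec k (S.remove i) := by
  simp [psiStar, ofBasis_basisVec, h]

theorem psiStar_of_notMem {i : ℤ} {S : Maya} (h : i ∉ S.occ) :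
    psiStar k i (basisVec k S) = 0 := by
  simp [psiStar, ofBasis_basisVec, h]

theorem psi_mul_self (i : ℤ) : psi k i * psi k i = 0 := by
  refine end_ext fun S => ?_
  by_cases h : i ∈ S.occ
  · simp [psi_of_mem h]
  · simp [psi_of_notMem h, psi_of_mem (k := k) (Maya.mem_add.2 (Or.inl rfl) : i ∈ (S.add i).occ)]

theorem psi_mul_psi (i j : ℤ) : psi k i * psi k j = -(psi k j * psi k i) := by
  rcases eq_or_ne i j with rfl | hij
  · rw [psi_mul_self]; exact (neg_zero (G := Module.End k (Wedge k))).symm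
  refine end_ext fun S => ?_
  simp only [Module.End.mul_apply, LinearMap.neg_apply]
  by_cases hi : i ∈ S.occ <;> by_cases hj : j ∈ S.occ
  · simp [psi_of_mem hi, psi_of_mem hj]
  · have : i ∈ (S.add j).occ := Maya.mem_add.2 (Or.inr hi)
    simp [psi_of_mem hi, psi_of_notMem hj, psi_of_mem this]
  · have : j ∈ (S.add i).occ := Maya.mem_add.2 (Or.inr hj)
    simp [psi_of_mem hj, psi_of_notMem hi, psi_of_mem this]
  · have h1 : i ∉ (S.add j).occ := by simp [Maya.mem_add, hi, hij]
    have h2 : j ∉ (S.add i).occ := by simp [Maya.mem_add, hj, hij.symm]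
    rw [psi_of_notMem hi, psi_of_notMem hj, map_zsmul, map_zsmul, psi_of_notMem h1,
      psi_of_notMem h2, smul_smul, smul_smul, ← neg_smul, S.add_comm i j, Maya.sign_add hi,
      Maya.sign_add hj]
    congr 1
    rcases lt_or_gt_of_ne hij with h | h <;> simp [h, h.not_gt, mul_comm]

/-- For `i ≠ j` both orders reach the same label, and exactly one of the two signs is flipped by the
other operator; for `i = j` exactly one of the two products survives on each basis vector. -/
theorem psiStar_mul_psi (i j : ℤ) :
    psiStar k i * psi k j = (if i = j then 1 else 0) - psi k j * psiStar k i := by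
  rcases eq_or_ne i j with rfl | hij
  · refine end_ext fun S => ?_
    by_cases h : i ∈ S.occ
    · simp [psi_of_mem h, psiStar_of_mem h, psi_of_notMem (S.notMem_remove i), smul_smul,
        Maya.sign_remove h, Maya.remove_add h, Maya.sign_mul_self]
    · simp [psi_of_notMem h, psiStar_of_notMem h,
        psiStar_of_mem (k := k) (Maya.mem_add.2 (Or.inl rfl) : i ∈ (S.add i).occ),
        Maya.sign_add h, Maya.add_remove h, smul_smul, Maya.sign_mul_self]
  refine end_ext fun S => ?_
  rw [if_neg hij, LinearMap.sub_apply, Module.End.mul_apply, Module.End.mul_apply,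
    LinearMap.zero_apply, zero_sub]
  by_cases hi : i ∈ S.occ <;> by_cases hj : j ∈ S.occ
  · have : j ∈ (S.remove i).occ := Maya.mem_remove.2 ⟨hj, hij.symm⟩
    simp [psi_of_mem hj, psiStar_of_mem hi, psi_of_mem this]
  · have h1 : i ∈ (S.add j).occ := Maya.mem_add.2 (Or.inr hi)
    have h2 : j ∉ (S.remove i).occ := by simp [Maya.mem_remove, hj]
    rw [psi_of_notMem hj, psiStar_of_mem hi, map_zsmul, map_zsmul, psiStar_of_mem h1,
      psi_of_notMem h2, smul_smul, smul_smul, ← neg_smul, S.add_remove_comm hij.symm,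
      Maya.sign_add hj, Maya.sign_remove hi]
    congr 1
    rcases lt_or_gt_of_ne hij with h | h <;> simp [h, h.not_gt, mul_comm]
  · simp [psi_of_mem hj, psiStar_of_notMem hi]
  · have : i ∉ (S.add j).occ := by simp [Maya.mem_add, hi, hij]
    simp [psi_of_notMem hj, psiStar_of_notMem hi, psiStar_of_notMem this]

theorem psiStar_mul_self (i : ℤ) : psiStar k i * psiStar k i = 0 := by
  refine end_ext fun S => ?_
  by_cases h : i ∈ S.occ
  · simp [psiStar_of_mem h, psiStar_of_notMem (S.notMem_remove i)]
  · simp [psiStar_of_notMem h]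

theorem psiStar_mul_psiStar (i j : ℤ) :
    psiStar k i * psiStar k j = -(psiStar k j * psiStar k i) := by
  rcases eq_or_ne i j with rfl | hij
  · rw [psiStar_mul_self]; exact (neg_zero (G := Module.End k (Wedge k))).symm
  refine end_ext fun S => ?_
  simp only [Module.End.mul_apply, LinearMap.neg_apply]
  by_cases hi : i ∈ S.occ <;> by_cases hj : j ∈ S.occ
  · have h1 : i ∈ (S.remove j).occ := Maya.mem_remove.2 ⟨hi, hij⟩
    have h2 : j ∈ (S.remove i).occ := Maya.mem_remove.2 ⟨hj, hij.symm⟩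
    rw [psiStar_of_mem hi, psiStar_of_mem hj, map_zsmul, map_zsmul, psiStar_of_mem h1,
      psiStar_of_mem h2, smul_smul, smul_smul, ← neg_smul, S.remove_comm i j,
      Maya.sign_remove hi, Maya.sign_remove hj]
    congr 1
    rcases lt_or_gt_of_ne hij with h | h <;> simp [h, h.not_gt, mul_comm]
  · have : j ∉ (S.remove i).occ := by simp [Maya.mem_remove, hj]
    simp [psiStar_of_notMem hj, psiStar_of_mem hi, psiStar_of_notMem this]
  · have : i ∉ (S.remove j).occ := by simp [Maya.mem_remove, hi]
    simp [psiStar_of_notMem hi, psiStar_of_mem hj, psiStar_of_notMem this]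
  · simp [psiStar_of_notMem hi, psiStar_of_notMem hj]

theorem EOp_of_ne {i j : ℤ} (h : i ≠ j) : EOp k i j = psi k i * psiStar k j := by
  unfold EOp
  split_ifs
  · rfl
  · refine LinearMap.ext fun v => ?_
    rw [psiStar_mul_psi, if_neg h.symm, LinearMap.neg_apply, LinearMap.sub_apply,
      LinearMap.zero_apply, zero_sub, neg_neg]

theorem psi_psi (i j : ℤ) (v : Wedge k) : psi k i (psi k j v) = -psi k j (psi k i v) :=
  LinearMap.congr_fun (psi_mul_psi i j) v

theorem psiStar_psiStar (i j : ℤ) (v : Wedge k) :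
    psiStar k i (psiStar k j v) = -psiStar k j (psiStar k i v) :=
  LinearMap.congr_fun (psiStar_mul_psiStar i j) v

theorem psiStar_psi (i j : ℤ) (v : Wedge k) :
    psiStar k i (psi k j v) = (if i = j then v else 0) - psi k j (psiStar k i v) := by
  have := LinearMap.congr_fun (psiStar_mul_psi (k := k) i j) v
  rw [LinearMap.sub_apply] at this
  split_ifs at this ⊢ with h <;> exact this

/-! ### The current operators -/

/-- A nonzero term needs `j` occupied and `j - n` vacant. Far up nothing is occupied and far down
nothing is vacant. -/
theorem support_psi_psiStar_add_finite {n : ℤ} (hn : n ≠ 0) (v : Wedge k) :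
    (Function.support fun j : ℤ => psi k (j - n) (psiStar k j v)).Finite := by
  induction v using Finsupp.induction_linear with
  | zero => simp
  | add v w hv hw =>
    refine (hv.union hw).subset ?_
    simp only [map_add]
    exact Function.support_add _ _
  | single S c =>
    -- The three sets cover `j ≥ 0`, `j - n < 0`, and the remaining window `j < 0 ≤ j - n`.
    have hfin : ({j | 0 ≤ j ∧ j ∈ S.occ} ∪ (fun i => i + n) '' {i | i < 0 ∧ i ∉ S.occ} ∪
        Set.Icc (-|n|) |n|).Finite :=
      (S.finite_pos.union (S.finite_neg.image _)).union (Set.finite_Icc _ _)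
    refine hfin.subset fun j hj => ?_
    rw [Function.mem_support] at hj
    have hs : Finsupp.single S c = c • basisVec k S := by simp [basisVec]
    rw [hs, map_smul, map_smul] at hj
    have hj := right_ne_zero_of_smul hj
    have h1 : j ∈ S.occ := by
      by_contra h
      simp [psiStar_of_notMem h] at hj
    have h2 : j - n ∉ S.occ := by
      intro h
      rw [psiStar_of_mem h1, map_zsmul, psi_of_mem (Maya.mem_remove.2 ⟨h, by omega⟩)] at hj
      simp at hj
    by_cases hj0 : 0 ≤ j
    · exact Or.inl (Or.inl ⟨hj0, h1⟩)
    by_cases hjn : j - n < 0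
    · exact Or.inl (Or.inr ⟨j - n, ⟨hjn, h2⟩, by simp⟩)
    · refine Or.inr ⟨?_, ?_⟩ <;> cases abs_cases n <;> omega

theorem alpha_apply {n : ℤ} (hn : n ≠ 0) (v : Wedge k) :
    alpha k n v = ∑ᶠ j : ℤ, psi k (j - n) (psiStar k j v) := by
  induction v using Finsupp.induction_linear with
  | zero => simp
  | add v w hv hw =>
    simp only [map_add]
    rw [hv, hw, finsum_add_distrib (support_psi_psiStar_add_finite hn v)
      (support_psi_psiStar_add_finite hn w)]
  | single S c =>
    have hs : Finsupp.single S c = c • basisVec k S := by simp [basisVec]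
    simp only [hs, map_smul]
    rw [← smul_finsum, alpha, ofBasis_basisVec]
    congr 1
    refine finsum_congr fun j => ?_
    rw [EOp_of_ne (by omega), Module.End.mul_apply]

theorem map_finsum_end (f : Module.End k (Wedge k)) {g : ℤ → Wedge k}
    (hg : (Function.support g).Finite) : f (∑ᶠ j, g j) = ∑ᶠ j, f (g j) :=
  f.toAddMonoidHom.map_finsum hg

/-- Commuting `ψ_c` past `ψ_{j-n} ψ_j^*` leaves a contraction only at `j = c`. -/
theorem alpha_psi {n : ℤ} (hn : n ≠ 0) (c : ℤ) (v : Wedge k) :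
    alpha k n (psi k c v) = psi k (c - n) v + psi k c (alpha k n v) := by
  have h1 := support_psi_psiStar_add_finite hn v
  rw [alpha_apply hn, alpha_apply hn, map_finsum_end _ h1]
  have h2 : ∀ j : ℤ, psi k (j - n) (psiStar k j (psi k c v)) =
      (if j = c then psi k (c - n) v else 0) + psi k c (psi k (j - n) (psiStar k j v)) := by
    intro j
    rw [psiStar_psi, map_sub, psi_psi (j - n) c, sub_neg_eq_add]
    split_ifs with h
    · rw [h]
    · simp
  rw [finsum_congr h2, finsum_add_distrib, finsum_eq_single _ c]
  · simp
  · intro j hj; simp [hj]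
  · refine (Set.finite_singleton c).subset fun j hj => ?_
    by_contra h
    simp_all
  · refine h1.subset fun j hj h => hj ?_
    simp_all

theorem alpha_psiStar {n : ℤ} (hn : n ≠ 0) (c : ℤ) (v : Wedge k) :
    alpha k n (psiStar k c v) = -psiStar k (c + n) v + psiStar k c (alpha k n v) := by
  have h1 := support_psi_psiStar_add_finite hn v
  rw [alpha_apply hn, alpha_apply hn, map_finsum_end _ h1]
  have h2 : ∀ j : ℤ, psi k (j - n) (psiStar k j (psiStar k c v)) =
      (if j = c + n then -psiStar k (c + n) v else 0) +
        psiStar k c (psi k (j - n) (psiStar k j v)) := by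
    intro j
    rw [psiStar_psi, psiStar_psiStar j c, map_neg]
    by_cases h : j = c + n
    · rw [if_pos h, if_pos (by omega), h]; abel
    · rw [if_neg h, if_neg (by omega)]; abel
  rw [finsum_congr h2, finsum_add_distrib, finsum_eq_single _ (c + n)]
  · simp
  · intro j hj; simp [hj]
  · refine (Set.finite_singleton (c + n)).subset fun j hj => ?_
    by_contra h
    simp_all
  · refine h1.subset fun j hj h => hj ?_
    simp_all

/-- The commutator is a sum of bilinears minus its own shift by `m`. Since `m + n ≠ 0`, both sums
are finite on `v` separately, so reindexing cancels them. -/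
theorem alpha_comm {m n : ℤ} (hm : m ≠ 0) (hn : n ≠ 0) (hmn : m + n ≠ 0) (v : Wedge k) :
    alpha k m (alpha k n v) = alpha k n (alpha k m v) := by
  have h0 := support_psi_psiStar_add_finite hn v
  have h1 := support_psi_psiStar_add_finite hn (alpha k m v)
  have h2 : (Function.support fun j : ℤ => psi k (j - n - m) (psiStar k j v)).Finite := by
    have := support_psi_psiStar_add_finite hmn v
    simp only [sub_sub]
    rwa [add_comm n m]
  have h3 : (Function.support fun j : ℤ => psi k (j - n) (psiStar k (j + m) v)).Finite := by
    refine (h2.image fun j => j - m).subset fun j hj => ⟨j + m, ?_, by simp⟩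
    have : j + m - n - m = j - n := by ring
    simpa only [Function.mem_support, this] using hj
  rw [alpha_apply hn v, alpha_apply hn (alpha k m v), map_finsum_end _ h0]
  have h4 : ∀ j : ℤ, alpha k m (psi k (j - n) (psiStar k j v)) =
      (psi k (j - n - m) (psiStar k j v) - psi k (j - n) (psiStar k (j + m) v)) +
        psi k (j - n) (psiStar k j (alpha k m v)) := by
    intro j
    rw [alpha_psi hm, alpha_psiStar hm, map_add, map_neg]
    abel
  rw [finsum_congr h4, finsum_add_distrib, finsum_sub_distrib h2 h3, add_eq_right, sub_eq_zero,
    ← finsum_comp_equiv (Equiv.addRight m)]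
  · refine finsum_congr fun j => ?_
    simp only [Equiv.coe_addRight]
    rw [show j + m - n - m = j - n by ring]
  · exact (h2.union h3).subset (Function.support_sub _ _)
  · exact h1

/-! ### The vectors labelled by one-row partitions -/

/-- The vacuum of charge `-1`. -/
def lowVacuum : Maya := Maya.vacuum.remove (-1)

theorem mem_lowVacuum {n : ℤ} : n ∈ lowVacuum.occ ↔ n < -1 := by
  simp only [lowVacuum, Maya.mem_remove, Maya.vacuum, Set.mem_ofPred_eq]
  omega

/-- The label `m - 1/2 ∧ -3/2 ∧ -5/2 ∧ ⋯` of the partition with one row of length `m`. -/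
def rowMaya (m : ℕ) : Maya := lowVacuum.add (m - 1)

theorem mem_rowMaya {m : ℕ} {n : ℤ} : n ∈ (rowMaya m).occ ↔ n = m - 1 ∨ n < -1 := by
  rw [rowMaya, Maya.mem_add, mem_lowVacuum]

theorem rowMaya_zero : rowMaya 0 = Maya.vacuum := by
  ext n
  rw [mem_rowMaya]
  change (n = ((0 : ℕ) : ℤ) - 1 ∨ n < -1) ↔ n < 0
  rw [Nat.cast_zero]
  constructor
  · rintro (h | h) <;> omega
  · intro h
    by_cases h1 : n = 0 - 1
    · exact Or.inl h1
    · exact Or.inr (by omega)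

theorem rowMaya_injective : Function.Injective rowMaya := by
  intro m n h
  have : (m : ℤ) - 1 ∈ (rowMaya n).occ := by rw [← h, mem_rowMaya]; simp
  rw [mem_rowMaya] at this
  omega

variable (k) in
/-- The vector labelled by the partition with one row of length `m`. -/
def rowVec (m : ℕ) : Wedge k := basisVec k (rowMaya m)

/-- This form lets the action of `α_n` on one-row vectors be computed from a commutator. No sign
appears, since no factor of `lowVacuum` lies above `m - 1 ≥ -1`. -/
theorem psi_lowVacuum (m : ℕ) : psi k (m - 1) (basisVec k lowVacuum) = rowVec k m := by
  rw [psi_of_notMem (by rw [mem_lowVacuum]; omega), rowVec, rowMaya]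
  have : lowVacuum.sign ((m : ℤ) - 1) = 1 := by
    rw [Maya.sign]
    convert pow_zero _
    rw [Set.ncard_eq_zero (lowVacuum.finite_above _)]
    ext n
    simp only [mem_lowVacuum, Set.mem_ofPred_eq, Set.mem_empty_iff_false, iff_false, not_and]
    omega
  rw [this, one_smul]

theorem psi_lowVacuum_of_lt {n : ℤ} (hn : n < -1) : psi k n (basisVec k lowVacuum) = 0 :=
  psi_of_mem (mem_lowVacuum.2 hn)

/-- A factor `j` would have to move down to `j - n`, which is already occupied. -/
theorem alpha_pos_lowVacuum {n : ℤ} (hn : 0 < n) : alpha k n (basisVec k lowVacuum) = 0 := by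
  rw [alpha_apply hn.ne']
  refine finsum_eq_zero_of_forall_eq_zero fun j => ?_
  by_cases hj : j < -1
  · rw [psiStar_of_mem (mem_lowVacuum.2 hj), map_zsmul, psi_of_mem, smul_zero]
    rw [Maya.mem_remove, mem_lowVacuum]
    omega
  · rw [psiStar_of_notMem (by rwa [mem_lowVacuum]), map_zero]

theorem alpha_pos_rowVec {i : ℕ} (hi : 0 < i) (m : ℕ) :
    alpha k i (rowVec k m) = if i ≤ m then rowVec k (m - i) else 0 := by
  rw [← psi_lowVacuum, alpha_psi (by omega), alpha_pos_lowVacuum (by omega), map_zero, add_zero]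
  split_ifs with h
  · rw [← psi_lowVacuum]
    congr 2
    omega
  · exact psi_lowVacuum_of_lt (by omega)

theorem alpha_neg_rowVec {i : ℕ} (hi : 0 < i) (m : ℕ) :
    alpha k (-i) (rowVec k m) =
      rowVec k (m + i) + psi k (m - 1) (alpha k (-i) (basisVec k lowVacuum)) := by
  rw [← psi_lowVacuum, alpha_psi (by omega), ← psi_lowVacuum]
  congr 3
  push_cast
  ring

/-- The reflection `i ↦ t + l - i` exchanges the two `ψ`'s, so the sum equals its own negative. -/
theorem sum_psi_psi_reflect [CharZero k] (t l : ℕ) (w : Wedge k) :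
    ∑ i ∈ Finset.Icc t l, psi k (l - i - 1) (psi k (i - t - 1) w) = 0 := by
  have h : ∑ i ∈ Finset.Icc t l, psi k (l - i - 1) (psi k (i - t - 1) w) =
      -∑ i ∈ Finset.Icc t l, psi k (l - i - 1) (psi k (i - t - 1) w) := by
    rw [← Finset.sum_neg_distrib]
    refine Finset.sum_nbij' (fun i => t + l - i) (fun i => t + l - i) ?_ ?_ ?_ ?_ ?_
    · intro i hi; rw [Finset.mem_Icc] at hi ⊢; omega
    · intro i hi; rw [Finset.mem_Icc] at hi ⊢; omega
    · intro i hi; rw [Finset.mem_Icc] at hi; omega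
    · intro i hi; rw [Finset.mem_Icc] at hi; omega
    · intro i hi
      rw [Finset.mem_Icc] at hi
      rw [psi_psi, Nat.cast_sub (by omega), Nat.cast_add]
      congr 3
      · ring
      · congr 1; ring
  have h2 : (2 : k) • ∑ i ∈ Finset.Icc t l, psi k (l - i - 1) (psi k (i - t - 1) w) = 0 := by
    rw [two_smul]
    nth_rewrite 1 [h]
    exact neg_add_cancel _
  exact (smul_eq_zero.1 h2).resolve_left two_ne_zero

/-- These are the terms in which `α_{-i}` moves a factor of the sea. Grouped by the moved factor `j
= -1 - t`, they form the antisymmetric sums above. -/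
theorem sum_psi_alpha_neg [CharZero k] (l : ℕ) :
    ∑ i ∈ Finset.Icc 1 l, psi k ((l - i : ℕ) - 1) (alpha k (-(i : ℤ)) (basisVec k lowVacuum))
      = 0 := by
  have hfin : ∀ i ∈ Finset.Icc 1 l, (Function.support fun j : ℤ =>
      psi k (j - -(i : ℤ)) (psiStar k j (basisVec k lowVacuum))).Finite := fun i hi =>
    support_psi_psiStar_add_finite (by rw [Finset.mem_Icc] at hi; omega) _
  have h1 : ∀ i ∈ Finset.Icc 1 l,
      psi k ((l - i : ℕ) - 1) (alpha k (-(i : ℤ)) (basisVec k lowVacuum)) =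
      ∑ᶠ j : ℤ, psi k (l - i - 1) (psi k (j - -(i : ℤ)) (psiStar k j (basisVec k lowVacuum))) := by
    intro i hi
    have hf := hfin i hi
    rw [Finset.mem_Icc] at hi
    rw [alpha_apply (by omega), map_finsum_end _ hf, Nat.cast_sub hi.2]
  rw [Finset.sum_congr rfl h1, ← finsum_sum_comm]
  · refine finsum_eq_zero_of_forall_eq_zero fun j => ?_
    by_cases hj : j < -1
    · obtain ⟨t, rfl⟩ : ∃ t : ℕ, j = -1 - t := ⟨(-1 - j).toNat, by omega⟩
      rw [← sum_psi_psi_reflect t l (psiStar k (-1 - t) (basisVec k lowVacuum))]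
      symm
      -- The terms with `i < t` vanish: the target `i - t - 1 < -1` differs from `j` and is still
      -- occupied.
      refine Finset.sum_subset_zero_on_sdiff (Finset.Icc_subset_Icc (by omega) le_rfl) ?_ ?_
      · intro i hi
        rw [Finset.mem_sdiff, Finset.mem_Icc, Finset.mem_Icc] at hi
        rw [psiStar_of_mem (mem_lowVacuum.2 hj), map_zsmul, psi_of_mem, smul_zero, map_zero]
        rw [Maya.mem_remove, mem_lowVacuum]
        omega
      · intro i _
        congr 3
        ring
    · refine Finset.sum_eq_zero fun i _ => ?_
      rw [psiStar_of_notMem (by rwa [mem_lowVacuum]), map_zero, map_zero]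
  · intro i hi
    refine (hfin i hi).subset fun j hj h => hj ?_
    simp_all

/-- Fermionic form of Newton's identity `l h_l = ∑ p_i h_{l-i}`. -/
theorem sum_alpha_neg_rowVec [CharZero k] (l : ℕ) :
    ∑ i ∈ Finset.Icc 1 l, alpha k (-(i : ℤ)) (rowVec k (l - i)) = (l : k) • rowVec k l := by
  have h : ∀ i ∈ Finset.Icc 1 l, alpha k (-(i : ℤ)) (rowVec k (l - i)) = rowVec k l +
      psi k ((l - i : ℕ) - 1) (alpha k (-(i : ℤ)) (basisVec k lowVacuum)) := by
    intro i hi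
    rw [Finset.mem_Icc] at hi
    rw [alpha_neg_rowVec (by omega), Nat.sub_add_cancel hi.2]
  rw [Finset.sum_congr rfl h, Finset.sum_add_distrib, sum_psi_alpha_neg, add_zero,
    Finset.sum_const, Nat.card_Icc, Nat.add_sub_cancel, Nat.cast_smul_eq_nsmul]

end Fermions

/-! ### Exponentials of commuting currents -/

section Exponential

variable {k : Type} [Field k] {M : Type*} [AddCommGroup M] [Module k M]

/-- The coefficient of `z ^ l` in `(∑_{j ≥ 1} T_j z ^ j / j) ^ n v`. -/
def currentPow (T : ℕ → Module.End k M) (v : M) : ℕ → ℕ → M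
  | 0, l => if l = 0 then v else 0
  | n + 1, l => ∑ j ∈ Finset.Icc 1 l, ((j : k)⁻¹) • T j (currentPow T v n (l - j))

/-- The coefficient of `z ^ l` in `exp (∑_{j ≥ 1} T_j z ^ j / j) v`. -/
def currentExp (T : ℕ → Module.End k M) (v : M) (l : ℕ) : M :=
  ∑ n ∈ Finset.range (l + 1), ((n.factorial : k)⁻¹) • currentPow T v n l

theorem currentPow_eq_zero (T : ℕ → Module.End k M) (v : M) {n l : ℕ} (h : l < n) :
    currentPow T v n l = 0 := by
  induction n generalizing l with
  | zero => omega
  | succ n ih =>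
    refine Finset.sum_eq_zero fun j hj => ?_
    rw [Finset.mem_Icc] at hj
    rw [ih (by omega), map_zero, smul_zero]

theorem currentExp_eq_sum (T : ℕ → Module.End k M) (v : M) {l N : ℕ} (h : l < N) :
    currentExp T v l = ∑ n ∈ Finset.range N, ((n.factorial : k)⁻¹) • currentPow T v n l := by
  refine Finset.sum_subset (Finset.range_mono h) fun n _ hn => ?_
  rw [Finset.mem_range] at hn
  rw [currentPow_eq_zero T v (by omega), smul_zero]

theorem currentExp_zero (T : ℕ → Module.End k M) (v : M) : currentExp T v 0 = v := by
  simp [currentExp, currentPow]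

theorem sum_Icc_sum_Icc_comm (l : ℕ) (f : ℕ → ℕ → M) :
    ∑ i ∈ Finset.Icc 1 l, ∑ j ∈ Finset.Icc 1 (l - i), f i j =
      ∑ j ∈ Finset.Icc 1 l, ∑ i ∈ Finset.Icc 1 (l - j), f i j := by
  refine Finset.sum_comm' fun i j => ?_
  simp only [Finset.mem_Icc]
  omega

/-- With `J = ∑ T_j z^j / j`, this is the `z^l` coefficient of `z∂(J^{n+1}) = (n+1) (z∂J) J^n`;
commutativity is what allows the differentiated factor to be moved to the front. -/
theorem smul_currentPow_succ [CharZero k] {T : ℕ → Module.End k M}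
    (hT : ∀ i j, 0 < i → 0 < j → ∀ v, T i (T j v) = T j (T i v)) (v : M) (n l : ℕ) :
    (l : k) • currentPow T v (n + 1) l =
      ((n : k) + 1) • ∑ j ∈ Finset.Icc 1 l, T j (currentPow T v n (l - j)) := by
  induction n generalizing l with
  | zero =>
    simp only [currentPow, Finset.smul_sum]
    refine Finset.sum_congr rfl fun j hj => ?_
    rw [Finset.mem_Icc] at hj
    have : (j : k) ≠ 0 := Nat.cast_ne_zero.2 (by omega)
    split_ifs with h
    · obtain rfl : j = l := by omega
      simp [smul_smul, this]
    · simp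
  | succ n ih =>
    -- Leibniz rule: `l = j + (l - j)` separates differentiating the first factor from
    -- differentiating the others.
    have h1 : (l : k) • currentPow T v (n + 2) l =
        ∑ j ∈ Finset.Icc 1 l, (T j (currentPow T v (n + 1) (l - j)) +
          (j : k)⁻¹ • T j (((l - j : ℕ) : k) • currentPow T v (n + 1) (l - j))) := by
      rw [currentPow, Finset.smul_sum]
      refine Finset.sum_congr rfl fun j hj => ?_
      rw [Finset.mem_Icc] at hj
      have : (j : k) ≠ 0 := Nat.cast_ne_zero.2 (by omega)
      rw [map_smul, smul_smul, smul_smul, Nat.cast_sub hj.2]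
      nth_rewrite 2 [← one_smul k (T j (currentPow T v (n + 1) (l - j)))]
      rw [← add_smul]
      congr 1
      field_simp
      ring
    have h2 : ∑ j ∈ Finset.Icc 1 l,
          (j : k)⁻¹ • T j (((l - j : ℕ) : k) • currentPow T v (n + 1) (l - j)) =
        ((n : k) + 1) • ∑ j ∈ Finset.Icc 1 l, T j (currentPow T v (n + 1) (l - j)) := by
      simp only [ih]
      simp only [currentPow, map_smul, map_sum, Finset.smul_sum]
      rw [sum_Icc_sum_Icc_comm]
      refine Finset.sum_congr rfl fun i hi => Finset.sum_congr rfl fun j hj => ?_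
      rw [Finset.mem_Icc] at hi hj
      rw [hT j i (by omega) (by omega), smul_comm, Nat.sub_right_comm]
    rw [h1, Finset.sum_add_distrib, h2]
    push_cast
    rw [add_smul ((n : k) + 1) (1 : k), one_smul, add_comm]

/-- Coefficient form of `z∂ exp J = (z∂J) exp J`. In characteristic zero it determines the
coefficients from the initial one. -/
theorem smul_currentExp [CharZero k] {T : ℕ → Module.End k M}
    (hT : ∀ i j, 0 < i → 0 < j → ∀ v, T i (T j v) = T j (T i v)) (v : M) (l : ℕ) :
    (l : k) • currentExp T v l = ∑ j ∈ Finset.Icc 1 l, T j (currentExp T v (l - j)) := by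
  have h1 : ∀ j ∈ Finset.Icc 1 l, T j (currentExp T v (l - j)) =
      ∑ n ∈ Finset.range l, T j (((n.factorial : k)⁻¹) • currentPow T v n (l - j)) := by
    intro j hj
    rw [Finset.mem_Icc] at hj
    rw [currentExp_eq_sum T v (show l - j < l by omega), map_sum]
  rw [Finset.sum_congr rfl h1, Finset.sum_comm, currentExp, Finset.sum_range_succ', smul_add,
    Finset.smul_sum]
  have h2 : (l : k) • ((Nat.factorial 0 : k)⁻¹) • currentPow T v 0 l = 0 := by
    rcases eq_or_ne l 0 with rfl | h
    · simp
    · simp [currentPow, h]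
  rw [h2, add_zero]
  refine Finset.sum_congr rfl fun n _ => ?_
  rw [smul_comm, smul_currentPow_succ hT, smul_smul, Finset.smul_sum]
  refine Finset.sum_congr rfl fun j _ => ?_
  rw [map_smul]
  congr 1
  have h3 : (n.factorial : k) ≠ 0 := Nat.cast_ne_zero.2 n.factorial_ne_zero
  have h4 : (n : k) + 1 ≠ 0 := Nat.cast_add_one_ne_zero n
  rw [Nat.factorial_succ]
  push_cast
  field_simp

end Exponential

/-! ### The creation currents at the principal specialization -/

section Principal

variable {k : Type} [Field k]

/-- The exponent of `Λ` in the principal specialization of a monomial. -/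
def monWeight (d : ℕ+ →₀ ℕ) : ℕ := d.sum fun j n => (j : ℕ) * n

theorem monWeight_add (d e : ℕ+ →₀ ℕ) : monWeight (d + e) = monWeight d + monWeight e :=
  Finsupp.sum_add_index' (by simp) (by intros; ring)

theorem monWeight_single (j : ℕ+) (n : ℕ) : monWeight (Finsupp.single j n) = (j : ℕ) * n := by
  simp [monWeight]

/-- Weight `l` forces every `j` in the support, and every exponent, to be at most `l`. -/
theorem finite_monWeight (l : ℕ) : {d : ℕ+ →₀ ℕ | monWeight d = l}.Finite := by
  refine (Set.finite_Iic (Finsupp.onFinset (Finset.Iic l.succPNat)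
    (fun j : ℕ+ => if (j : ℕ) ≤ l then l else 0) ?_)).subset ?_
  · intro j hj
    have : (j : ℕ) ≤ l := by by_contra h; simp [h] at hj
    rw [Finset.mem_Iic, ← PNat.coe_le_coe, Nat.succPNat_coe]
    omega
  · rintro d rfl
    rw [Set.mem_Iic]
    intro j
    by_cases hj : d j = 0
    · simp [hj]
    have h1 : (j : ℕ) * d j ≤ monWeight d :=
      Finset.single_le_sum (f := fun j : ℕ+ => (j : ℕ) * d j) (fun _ _ => Nat.zero_le _)
        (Finsupp.mem_support_iff.2 hj)
    have h2 : (j : ℕ) ≤ (j : ℕ) * d j := Nat.le_mul_of_pos_right _ (Nat.pos_of_ne_zero hj)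
    have h3 : d j ≤ (j : ℕ) * d j := Nat.le_mul_of_pos_left _ j.pos
    rw [Finsupp.onFinset_apply, if_pos (h2.trans h1)]
    exact h3.trans h1

theorem mem_finite_monWeight {l : ℕ} {d : ℕ+ →₀ ℕ} :
    d ∈ (finite_monWeight l).toFinset ↔ monWeight d = l := by
  rw [Set.Finite.mem_toFinset]; rfl

theorem sub_single_add {d : ℕ+ →₀ ℕ} {j : ℕ+} (hj : j ∈ d.support) :
    d - Finsupp.single j 1 + Finsupp.single j 1 = d := by
  refine tsub_add_cancel_of_le ?_
  rw [Finsupp.single_le_iff]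
  exact Nat.one_le_iff_ne_zero.2 (Finsupp.mem_support_iff.1 hj)

/-- The coefficient of `Λ ^ l` in the specialization `X_j ↦ u Λ ^ j`. -/
def specialize (u : k) (F : WedgeSeries k) (l : ℕ) : Wedge k :=
  ∑ d ∈ (finite_monWeight l).toFinset, u ^ d.degree • F d

theorem specialize_vacSeries (u : k) (l : ℕ) :
    specialize u (vacSeries k) l = if l = 0 then basisVec k Maya.vacuum else 0 := by
  have h0 : monWeight 0 = 0 := Finsupp.sum_zero_index
  split_ifs with h
  · subst h
    rw [specialize, Finset.sum_eq_single 0]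
    · simp [vacSeries]
    · intro d _ hd
      rw [vacSeries, Pi.single_eq_of_ne hd, smul_zero]
    · intro h
      exact absurd (mem_finite_monWeight.2 h0) h
  · refine Finset.sum_eq_zero fun d hd => ?_
    rw [mem_finite_monWeight] at hd
    have : d ≠ 0 := by rintro rfl; exact h (hd.symm.trans h0)
    rw [vacSeries, Pi.single_eq_of_ne this, smul_zero]

/-- Multiplication by `X_j` becomes a shift of the `Λ`-degree by `j`, through the bijection between
pairs `(d, j)` with `j` in the support of `d` and pairs `(j, d - e_j)`. -/
theorem specialize_currentMinus (u : k) (t : ℕ+ → k) (F : WedgeSeries k) (l : ℕ) :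
    specialize u (currentMinus t F) l = ∑ j ∈ Finset.Icc 1 l,
      ((j : k)⁻¹) • ((t j.toPNat' * u) • alpha k (-(j : ℤ))) (specialize u F (l - j)) := by
  simp only [specialize, currentMinus, Finset.smul_sum, map_sum]
  rw [Finset.sum_sigma', Finset.sum_sigma']
  refine Finset.sum_nbij' (fun x => ⟨(x.2 : ℕ), x.1 - Finsupp.single x.2 1⟩)
    (fun y => ⟨y.2 + Finsupp.single y.1.toPNat' 1, y.1.toPNat'⟩) ?_ ?_ ?_ ?_ ?_
  · rintro ⟨d, j⟩ h
    simp only [Finset.mem_sigma, mem_finite_monWeight, Finset.mem_Icc] at h ⊢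
    have h1 := congrArg monWeight (sub_single_add h.2)
    rw [monWeight_add, monWeight_single] at h1
    have := j.pos
    omega
  · rintro ⟨j, d⟩ h
    simp only [Finset.mem_sigma, mem_finite_monWeight, Finset.mem_Icc] at h ⊢
    refine ⟨?_, by simp⟩
    rw [monWeight_add, monWeight_single, PNat.toPNat'_coe (by omega)]
    omega
  · rintro ⟨d, j⟩ h
    simp only [Finset.mem_sigma] at h
    simp [sub_single_add h.2]
  · rintro ⟨j, d⟩ h
    simp only [Finset.mem_sigma, Finset.mem_Icc] at h
    simp [PNat.toPNat'_coe h.1.1]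
  · rintro ⟨d, j⟩ h
    simp only [Finset.mem_sigma] at h
    have h1 : d.degree = (d - Finsupp.single j 1).degree + 1 := by
      conv_lhs => rw [← sub_single_add h.2, map_add, Finsupp.degree_single]
    simp only [LinearMap.smul_apply, map_smul, smul_smul, h1, PNat.coe_toPNat']
    congr 1
    ring

/-- The operators `t_j u α_{-j}`. -/
def minusOps (u : k) (t : ℕ+ → k) (j : ℕ) : Module.End k (Wedge k) :=
  (t j.toPNat' * u) • alpha k (-(j : ℤ))

theorem specialize_iterate (u : k) (t : ℕ+ → k) (n l : ℕ) :
    specialize u ((currentMinus t)^[n] (vacSeries k)) l =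
      currentPow (minusOps u t) (basisVec k Maya.vacuum) n l := by
  induction n generalizing l with
  | zero => simp [specialize_vacSeries, currentPow]
  | succ n ih =>
    rw [Function.iterate_succ_apply', specialize_currentMinus, currentPow]
    simp only [ih]
    rfl

theorem currentMinus_iterate_eq_zero (t : ℕ+ → k) {n : ℕ} {d : ℕ+ →₀ ℕ} (h : d.degree < n) :
    ((currentMinus t)^[n] (vacSeries k)) d = 0 := by
  induction n generalizing d with
  | zero => omega
  | succ n ih =>
    rw [Function.iterate_succ_apply', currentMinus]
    refine Finset.sum_eq_zero fun j hj => ?_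
    have h1 := congrArg Finsupp.degree (sub_single_add hj)
    rw [map_add, Finsupp.degree_single] at h1
    rw [ih (by omega), map_zero, smul_zero]

theorem degree_le_monWeight (d : ℕ+ →₀ ℕ) : d.degree ≤ monWeight d := by
  rw [monWeight, Finsupp.degree_apply, Finsupp.sum]
  exact Finset.sum_le_sum fun j _ => Nat.le_mul_of_pos_left _ j.pos

/-- The `n`-th power of the current only reaches monomials of degree at least `n`, and degree is at
most weight, so a truncation at `l` serves all monomials of weight `l`. -/
theorem specialize_GammaMinus (u : k) (t : ℕ+ → k) (l : ℕ) :
    specialize u (GammaMinus t (vacSeries k)) l =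
      currentExp (minusOps u t) (basisVec k Maya.vacuum) l := by
  have h : ∀ d ∈ (finite_monWeight l).toFinset, u ^ d.degree • GammaMinus t (vacSeries k) d =
      ∑ n ∈ Finset.range (l + 1), ((n.factorial : k)⁻¹) •
        (u ^ d.degree • ((currentMinus t)^[n] (vacSeries k)) d) := by
    intro d hd
    rw [mem_finite_monWeight] at hd
    rw [GammaMinus, finsum_eq_sum_of_support_subset (s := Finset.range (l + 1)), Finset.smul_sum]
    · exact Finset.sum_congr rfl fun n _ => smul_comm _ _ _
    · intro n hn
      by_contra h
      rw [Finset.mem_coe, Finset.mem_range] at h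
      have := degree_le_monWeight d
      exact hn (by simp only [currentMinus_iterate_eq_zero t (show d.degree < n by omega), smul_zero])
  rw [specialize, Finset.sum_congr rfl h, Finset.sum_comm, currentExp]
  refine Finset.sum_congr rfl fun n _ => ?_
  rw [← Finset.smul_sum, ← specialize_iterate]
  rfl

/-- The variables become the power sums of the single variable `βΛ`, for which only one-row Schur
functions survive. The proof compares the two Newton recursions, dividing by `l` in characteristic
zero. -/
theorem specialize_GammaMinus_eq_rowVec [CharZero k] (u : k) (t : ℕ+ → k) (β : k)
    (ht : ∀ j : ℕ+, t j * u = β ^ (j : ℕ)) (l : ℕ) :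
    specialize u (GammaMinus t (vacSeries k)) l = β ^ l • rowVec k l := by
  have hT : ∀ i j, 0 < i → 0 < j → ∀ v,
      minusOps u t i (minusOps u t j v) = minusOps u t j (minusOps u t i v) := by
    intro i j hi hj v
    simp only [minusOps, LinearMap.smul_apply, map_smul]
    rw [alpha_comm (by omega) (by omega) (by omega), smul_comm]
  rw [specialize_GammaMinus]
  induction l using Nat.strong_induction_on with
  | _ l ih =>
    rcases eq_or_ne l 0 with rfl | hl
    · rw [currentExp_zero, pow_zero, one_smul, rowVec, rowMaya_zero]
    have h1 := smul_currentExp hT (basisVec k Maya.vacuum) l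
    have h2 : ∀ j ∈ Finset.Icc 1 l, minusOps u t j
        (currentExp (minusOps u t) (basisVec k Maya.vacuum) (l - j)) =
        β ^ l • alpha k (-(j : ℤ)) (rowVec k (l - j)) := by
      intro j hj
      rw [Finset.mem_Icc] at hj
      rw [ih _ (by omega), minusOps, LinearMap.smul_apply, map_smul, smul_smul, ht,
        PNat.toPNat'_coe (by omega), ← pow_add, Nat.add_sub_cancel' hj.2]
    rw [Finset.sum_congr rfl h2, ← Finset.smul_sum, sum_alpha_neg_rowVec, smul_comm] at h1
    exact smul_right_injective _ (Nat.cast_ne_zero.2 hl : (l : k) ≠ 0) h1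

end Principal

/-! ### The annihilation currents on one-row vectors -/

section Annihilation

variable {k : Type} [Field k]

theorem currentPlus_rowVec (p : ℕ+ → k) (m : ℕ) :
    currentPlus p (rowVec k m) =
      ∑ i ∈ Finset.Icc 1 m, (p i.toPNat' / (i : k)) • rowVec k (m - i) := by
  have h : ∀ i : ℕ+, alpha k (i : ℕ) (basisVec k (rowMaya m)) =
      if (i : ℕ) ≤ m then rowVec k (m - i) else 0 := fun i => alpha_pos_rowVec i.pos m
  rw [rowVec, currentPlus, ofBasis_basisVec]
  simp only [h]
  rw [finsum_eq_sum_of_support_subset (s := (Finset.Icc 1 m).image Nat.toPNat')]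
  · rw [Finset.sum_image]
    · refine Finset.sum_congr rfl fun i hi => ?_
      rw [Finset.mem_Icc] at hi
      rw [PNat.toPNat'_coe (by omega), if_pos hi.2]
    · intro i hi j hj hij
      rw [Finset.mem_coe, Finset.mem_Icc] at hi hj
      have := congrArg PNat.val hij
      change (i.toPNat' : ℕ) = (j.toPNat' : ℕ) at this
      rwa [PNat.toPNat'_coe (by omega), PNat.toPNat'_coe (by omega)] at this
  · intro i hi
    rw [Finset.coe_image, Set.mem_image]
    refine ⟨i, ?_, PNat.coe_toPNat' i⟩
    rw [Finset.mem_coe, Finset.mem_Icc]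
    refine ⟨i.pos, ?_⟩
    by_contra h
    exact hi (by simp only [if_neg h, smul_zero])

theorem currentPlus_pow_rowVec_eq_zero (p : ℕ+ → k) {m n : ℕ} (h : m < n) :
    (currentPlus p ^ n) (rowVec k m) = 0 := by
  induction n generalizing m with
  | zero => omega
  | succ n ih =>
    rw [pow_succ, Module.End.mul_apply, currentPlus_rowVec, map_sum]
    refine Finset.sum_eq_zero fun i hi => ?_
    rw [Finset.mem_Icc] at hi
    rw [map_smul, ih (by omega), smul_zero]

/-- Multiplication by `p_j` on the ground field. -/
def plusOps (p : ℕ+ → k) (j : ℕ) : Module.End k k := p j.toPNat' • LinearMap.id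

-- Reaching the vacuum from row `m` removes boxes of total number `m`, which is the recursion
-- defining `currentPow` with scalar coefficients.
open Classical in
theorem currentPlus_pow_rowVec_vacuum (p : ℕ+ → k) (m n : ℕ) :
    (currentPlus p ^ n) (rowVec k m) Maya.vacuum = currentPow (plusOps p) 1 n m := by
  induction n generalizing m with
  | zero =>
    rw [pow_zero, Module.End.one_apply, currentPow, rowVec, basisVec, ← rowMaya_zero,
      Finsupp.single_apply]
    simp only [rowMaya_injective.eq_iff]
  | succ n ih =>
    rw [pow_succ, Module.End.mul_apply, currentPlus_rowVec, map_sum, Finsupp.finsetSum_apply,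
      currentPow]
    refine Finset.sum_congr rfl fun i _ => ?_
    rw [map_smul, Finsupp.smul_apply, ih]
    simp only [plusOps, LinearMap.smul_apply, LinearMap.id_apply, smul_eq_mul]
    ring

theorem GammaPlus_rowVec_vacuum (p : ℕ+ → k) (m : ℕ) :
    GammaPlus p (rowVec k m) Maya.vacuum = currentExp (plusOps p) 1 m := by
  rw [rowVec, GammaPlus, ofBasis_basisVec,
    finsum_eq_sum_of_support_subset (s := Finset.range (m + 1))]
  · rw [Finsupp.finsetSum_apply, currentExp]
    refine Finset.sum_congr rfl fun n _ => ?_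
    rw [Finsupp.smul_apply, ← rowVec, currentPlus_pow_rowVec_vacuum]
  · intro n hn
    by_contra h
    rw [Finset.mem_coe, Finset.mem_range] at h
    refine hn ?_
    change _ • (currentPlus p ^ n) (rowVec k m) = 0
    rw [currentPlus_pow_rowVec_eq_zero p (by omega), smul_zero]

theorem EOp_self_apply (j : ℤ) (S : Maya) [Decidable (j ∈ S.occ)] :
    EOp k j j (basisVec k S) =
      if 0 ≤ j then (if j ∈ S.occ then basisVec k S else 0)
      else (if j ∈ S.occ then 0 else -basisVec k S) := by
  unfold EOp
  by_cases h : j ∈ S.occ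
  · have h1 : psi k j (psiStar k j (basisVec k S)) = basisVec k S := by
      rw [psiStar_of_mem h, map_zsmul, psi_of_notMem (S.notMem_remove j), smul_smul,
        Maya.sign_remove h, if_neg (lt_irrefl j), Maya.sign_mul_self, one_smul,
        Maya.remove_add h]
    split_ifs
    · exact h1
    · rw [LinearMap.neg_apply, Module.End.mul_apply, psi_of_mem h, map_zero, neg_zero]
  · have h1 : psiStar k j (psi k j (basisVec k S)) = basisVec k S := by
      rw [psiStar_psi, if_pos rfl, psiStar_of_notMem h, map_zero, sub_zero]
    split_ifs
    · rw [Module.End.mul_apply, psiStar_of_notMem h, map_zero]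
    · rw [LinearMap.neg_apply, Module.End.mul_apply, h1]

end Annihilation

/-- Relative to the vacuum there is a particle at `m - 1/2` and a hole at `-1/2`, contributing `((m
- 1/2)² - (1/2)²)/2`; for `m = 0` the two positions coincide. -/
theorem F2eig_rowMaya (m : ℕ) : F2eig (rowMaya m) = ((m : ℚ) ^ 2 - m) / 2 := by
  classical
  have h1 : F2 ℚ (basisVec ℚ (rowMaya m)) =
      (((m : ℚ) ^ 2 - m) / 2) • basisVec ℚ (rowMaya m) := by
    rw [F2, ofBasis_basisVec]
    simp only [EOp_self_apply, mem_rowMaya]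
    rcases Nat.eq_zero_or_pos m with rfl | hm
    · rw [finsum_eq_zero_of_forall_eq_zero]
      · simp
      · intro j
        split_ifs
        all_goals first | omega | simp
    · rw [finsum_eq_sum_of_support_subset (s := {(m : ℤ) - 1, -1}), Finset.sum_pair (by omega)]
      · rw [if_pos (by omega), if_pos (by omega), if_neg (by omega), if_neg (by omega), smul_neg,
          ← sub_eq_add_neg, ← sub_smul]
        congr 1
        push_cast
        ring
      · intro j hj
        by_contra h
        simp only [Finset.coe_insert, Finset.coe_singleton, Set.mem_insert_iff,
          Set.mem_singleton_iff, not_or] at h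
        refine hj ?_
        dsimp only
        split_ifs
        all_goals first | omega | simp
  rw [F2eig, h1]
  simp [basisVec]

/-! ### The field of Laurent series -/

section Laurent

/-- Complex constants as a ring homomorphism. -/
def constHom : ℂ →+* K := (HahnSeries.C : ℂ →+* LaurentSeries ℂ)

theorem const_eq (c : ℂ) : const c = constHom c := rfl

instance : CharZero K := charZero_of_injective_ringHom constHom.injective

theorem K.ext {f g : K} (h : ∀ n, f.coeff n = g.coeff n) : f = g :=
  HahnSeries.ext (funext h)

theorem expH_add (c d : ℂ) : expH (c + d) = expH c * expH d := by
  have := PowerSeries.exp_mul_exp_eq_exp_add c d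
  rw [expH, expH, expH, ← this]
  exact map_mul _ _ _

theorem coeff_expH (c : ℂ) (n : ℕ) : (expH c).coeff n = c ^ n / n.factorial := by
  change (HahnSeries.ofPowerSeries ℤ ℂ (PowerSeries.rescale c (PowerSeries.exp ℂ))).coeff (n : ℤ)
    = _
  have := HahnSeries.ofPowerSeries_apply_coeff (Γ := ℤ)
    (PowerSeries.rescale c (PowerSeries.exp ℂ)) n
  simp [PowerSeries.coeff_exp, div_eq_mul_inv] at this ⊢

theorem expH_zero : expH 0 = 1 := by
  have h := expH_add 0 0
  rw [add_zero] at h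
  have h0 : expH 0 ≠ 0 := fun h0 => by
    have h1 := coeff_expH 0 0
    rw [h0] at h1
    simp at h1
    exact zero_ne_one h1
  exact (mul_eq_left₀ h0).1 h.symm

theorem coeff_expH_of_neg (c : ℂ) {n : ℤ} (hn : n < 0) : (expH c).coeff n = 0 := by
  apply HahnSeries.embDomain_of_notMem_range
  rintro ⟨m, hm⟩
  simp at hm
  omega

/-- The coefficient of `ħ` recovers `c`. -/
theorem expH_injective : Function.Injective expH := by
  intro c d h
  have h1 : (expH c).coeff (1 : ℕ) = (expH d).coeff (1 : ℕ) := by rw [h]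
  rw [coeff_expH, coeff_expH] at h1
  simpa using h1

theorem coeff_negH (f : K) (n : ℤ) :
    (negH f).coeff n = ((n.negOnePow : ℤ) : ℂ) * f.coeff n := rfl

theorem negH_const (c : ℂ) : negH (const c) = const c := by
  refine K.ext fun n => ?_
  rw [coeff_negH]
  rcases eq_or_ne n 0 with rfl | hn
  · simp
  · have : (const c).coeff n = 0 := HahnSeries.coeff_single_of_ne hn
    rw [this, mul_zero]

theorem negH_expH (c : ℂ) : negH (expH c) = expH (-c) := by
  refine K.ext fun n => ?_
  rw [coeff_negH]
  rcases lt_or_ge n 0 with hn | hn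
  · rw [coeff_expH_of_neg _ hn, coeff_expH_of_neg _ hn, mul_zero]
  · lift n to ℕ using hn
    rw [coeff_expH, coeff_expH, neg_pow, mul_div_assoc]
    congr 1
    simp [Int.negOnePow_def]

theorem Apow_add (a : ℂ) (r s : ℚ) : Apow a (r + s) = Apow a r * Apow a s := by
  rw [Apow, Apow, Apow, ← Complex.exp_add]
  push_cast
  ring_nf

theorem Apow_ne_zero (a : ℂ) (r : ℚ) : Apow a r ≠ 0 := Complex.exp_ne_zero _

theorem Apow_natCast_mul (a : ℂ) (n : ℕ) (r : ℚ) : Apow a (n * r) = Apow a r ^ n := by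
  rw [Apow, Apow, ← Complex.exp_nat_mul]
  push_cast
  ring_nf

end Laurent

/-! ### The wave function in terms of complete homogeneous functions -/

theorem coeff_prod_principal (Q : ℕ) (d : ℕ+ →₀ ℕ) (l : ℕ) :
    PowerSeries.coeff l (d.prod fun j n => principal Q j ^ n) =
      if monWeight d = l then ((Q : K)⁻¹) ^ d.degree else 0 := by
  have h : (d.prod fun j n => principal Q j ^ n) =
      PowerSeries.C (((Q : K)⁻¹) ^ d.degree) * PowerSeries.X ^ monWeight d := by
    simp only [principal, mul_pow, Finsupp.prod, Finset.prod_mul_distrib, ← pow_mul,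
      Finset.prod_pow_eq_pow_sum, map_pow]
    rfl
  rw [h, PowerSeries.coeff_C_mul, PowerSeries.coeff_X_pow]
  simp only [eq_comm (a := l), mul_ite, mul_one, mul_zero]

/-- The operators to the left of the creation exponential form a linear functional `L`, which passes
through the finite substitution sum. The factor `Q` in `p̃_j` cancels the `Q⁻¹` of the principal
specialization. -/
theorem coeff_Psi (P : ℤ) {Q : ℕ} (hQ : 0 < Q) (a : ℂ) (l : ℕ) :
    PowerSeries.coeff l (Psi P Q a) = negH (const (Apow a (l * slope P Q)) *
      (expH ((slope P Q : ℂ) * (((l : ℂ) ^ 2 - l) / 2)) * currentExp (plusOps (pStar a)) 1 l)) := by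
  let t : ℕ+ → K := fun j => (Q : K) * const (Apow a ((j : ℕ) * slope P Q))
  let L : Wedge K →ₗ[K] K := Finsupp.lapply Maya.vacuum ∘ₗ GammaPlus (pStar a) ∘ₗ
    expF2 (slope P Q)
  have hQ' : (Q : K) ≠ 0 := Nat.cast_ne_zero.2 hQ.ne'
  have h1 : PowerSeries.coeff l (MvPowerSeries.subst (principal Q) (Zext P Q a (pStar a)) :
      PowerSeries K) = L (specialize (Q : K)⁻¹ (GammaMinus t (vacSeries K)) l) := by
    rw [PowerSeries.coeff, MvPowerSeries.coeff_subst (principal_hasSubst Q)]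
    have h2 : ∀ d : ℕ+ →₀ ℕ, MvPowerSeries.coeff d (Zext P Q a (pStar a)) •
        MvPowerSeries.coeff (Finsupp.single () l) (d.prod fun j n => principal Q j ^ n) =
        if monWeight d = l then L ((Q : K)⁻¹ ^ d.degree • GammaMinus t (vacSeries K) d) else 0 := by
      intro d
      have := coeff_prod_principal Q d l
      rw [PowerSeries.coeff] at this
      rw [this, map_smul]
      split_ifs
      · rw [smul_eq_mul, smul_eq_mul, mul_comm]
        rfl
      · rw [smul_zero]
    rw [finsum_congr h2, finsum_eq_sum_of_support_subset (s := (finite_monWeight l).toFinset),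
      specialize, map_sum]
    · refine Finset.sum_congr rfl fun d hd => ?_
      rw [if_pos (mem_finite_monWeight.1 hd)]
    · intro d hd
      rw [Finset.mem_coe, mem_finite_monWeight]
      by_contra h
      exact hd (if_neg h)
  have h3 : specialize (Q : K)⁻¹ (GammaMinus t (vacSeries K)) l =
      const (Apow a (slope P Q)) ^ l • rowVec K l := by
    refine specialize_GammaMinus_eq_rowVec _ _ _ (fun j => ?_) l
    simp only [t, Apow_natCast_mul, const_eq, map_pow]
    field_simp
  have h4 : expF2 (slope P Q) (rowVec K l) =
      expH ((slope P Q : ℂ) * (((l : ℂ) ^ 2 - l) / 2)) • rowVec K l := by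
    rw [rowVec, expF2, ofBasis_basisVec, F2eig_rowMaya]
    push_cast
    rfl
  rw [Psi, PowerSeries.coeff_map, h1, h3, map_smul]
  congr 1
  rw [Apow_natCast_mul, const_eq, const_eq, map_pow, smul_eq_mul]
  congr 1
  simp only [L, LinearMap.comp_apply]
  rw [h4, map_smul, map_smul, Finsupp.lapply_apply, GammaPlus_rowVec_vacuum, smul_eq_mul]

/-! ### Linear differential equations for formal power series -/

section ODE

variable {k : Type} [Field k]

theorem eq_zero_of_derivative_eq_mul [CharZero k] {M Z : PowerSeries k}
    (h : PowerSeries.derivative k Z = M * Z) (h0 : PowerSeries.coeff 0 Z = 0) : Z = 0 := by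
  ext n
  rw [map_zero]
  induction n using Nat.strong_induction_on with
  | _ n ih =>
    cases n with
    | zero => exact h0
    | succ n =>
      have h1 := congrArg (PowerSeries.coeff n) h
      rw [PowerSeries.coeff_derivative, PowerSeries.coeff_mul, Finset.sum_eq_zero] at h1
      · exact (mul_eq_zero.1 h1).resolve_right (Nat.cast_add_one_ne_zero n)
      · intro x hx
        rw [Finset.HasAntidiagonal.mem_antidiagonal] at hx
        rw [ih _ (by omega), mul_zero]

theorem derivative_mk_of_recursion {p h : ℕ → k}
    (hp : ∀ l : ℕ, (l : k) * h l = ∑ j ∈ Finset.Icc 1 l, p j * h (l - j)) :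
    PowerSeries.derivative k (PowerSeries.mk h) =
      PowerSeries.mk (fun n => p (n + 1)) * PowerSeries.mk h := by
  ext n
  rw [PowerSeries.coeff_derivative, PowerSeries.coeff_mk, mul_comm, PowerSeries.coeff_mul,
    Finset.Nat.sum_antidiagonal_eq_sum_range_succ_mk]
  have := hp (n + 1)
  push_cast at this
  rw [this, ← Finset.Ico_succ_right_eq_Icc, Finset.sum_Ico_eq_sum_range]
  refine Finset.sum_congr rfl fun i _ => ?_
  simp only [PowerSeries.coeff_mk, add_comm 1 i]
  congr 2
  omega

theorem one_sub_mul_mk_pow (c : k) :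
    (1 - PowerSeries.C c * PowerSeries.X) * PowerSeries.mk (fun n => c ^ n) = 1 := by
  rw [sub_mul, one_mul]
  ext n
  rw [map_sub, mul_assoc, PowerSeries.coeff_C_mul]
  cases n with
  | zero => simp
  | succ n =>
    rw [PowerSeries.coeff_succ_X_mul, PowerSeries.coeff_mk, PowerSeries.coeff_mk,
      PowerSeries.coeff_one, if_neg (Nat.succ_ne_zero n), pow_succ']
    ring

/-- The logarithmic derivative of `1 - cX` is `-c/(1 - cX)`, written here as a geometric series. -/
theorem derivative_one_sub_mul {c : k} {N Y : PowerSeries k}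
    (h : PowerSeries.derivative k Y = N * Y) :
    PowerSeries.derivative k ((1 - PowerSeries.C c * PowerSeries.X) * Y) =
      (N - PowerSeries.C c * PowerSeries.mk (fun n => c ^ n)) *
        ((1 - PowerSeries.C c * PowerSeries.X) * Y) := by
  have h1 := one_sub_mul_mk_pow c
  have h2 : PowerSeries.derivative k (1 - PowerSeries.C c * PowerSeries.X) = -PowerSeries.C c := by
    rw [map_sub, Derivation.leibniz]
    simp [PowerSeries.derivative_C, PowerSeries.derivative_X]
  rw [Derivation.leibniz, h, h2, smul_eq_mul, smul_eq_mul]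
  linear_combination (PowerSeries.C c * Y) * h1

/-- The `q`-difference recursion for the coefficients of `exp (∑ p_i z ^ i / i)` when
`p_i = (c ^ i - d ^ i) / (q ^ i - q ^ {-i})`. -/
theorem q_recursion [CharZero k] {q c d : k} {p h : ℕ → k}
    (hp : ∀ j : ℕ, 0 < j → p j * (q ^ j - q⁻¹ ^ j) = c ^ j - d ^ j)
    (hh : ∀ l : ℕ, (l : k) * h l = ∑ j ∈ Finset.Icc 1 l, p j * h (l - j)) (l : ℕ) :
    h (l + 1) * (q ^ (l + 1) - q⁻¹ ^ (l + 1)) = h l * (c * q ^ l - d * q⁻¹ ^ l) := by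
  have hscale : ∀ r : k, ∀ l : ℕ, (l : k) * (r ^ l * h l) =
      ∑ j ∈ Finset.Icc 1 l, (r ^ j * p j) * (r ^ (l - j) * h (l - j)) := by
    intro r l
    rw [mul_left_comm, hh, Finset.mul_sum]
    refine Finset.sum_congr rfl fun j hj => ?_
    rw [Finset.mem_Icc] at hj
    nth_rewrite 1 [← Nat.add_sub_cancel' hj.2]
    rw [pow_add]
    ring
  have h1 := derivative_one_sub_mul (c := c) (derivative_mk_of_recursion (hscale q))
  have h2 := derivative_one_sub_mul (c := d) (derivative_mk_of_recursion (hscale q⁻¹))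
  -- The formula for `p_j` says exactly that `(1 - cX) H(qX)` and `(1 - dX) H(q⁻¹X)` have equal
  -- logarithmic derivatives.
  have hM : PowerSeries.mk (fun n => q ^ (n + 1) * p (n + 1)) -
        PowerSeries.C c * PowerSeries.mk (fun n => c ^ n) =
      PowerSeries.mk (fun n => q⁻¹ ^ (n + 1) * p (n + 1)) -
        PowerSeries.C d * PowerSeries.mk (fun n => d ^ n) := by
    ext n
    simp only [map_sub, PowerSeries.coeff_C_mul, PowerSeries.coeff_mk]
    linear_combination hp (n + 1) n.succ_pos
  rw [hM] at h1
  -- Both products have constant term `h 0`, so they coincide.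
  have h3 := eq_zero_of_derivative_eq_mul
    (Z := (1 - PowerSeries.C c * PowerSeries.X) * PowerSeries.mk (fun n => q ^ n * h n) -
      (1 - PowerSeries.C d * PowerSeries.X) * PowerSeries.mk (fun n => q⁻¹ ^ n * h n))
    (by rw [map_sub, h1, h2, ← mul_sub]) (by simp)
  have h4 := congrArg (PowerSeries.coeff (l + 1)) h3
  simp only [sub_mul, one_mul, map_sub, mul_assoc, PowerSeries.coeff_C_mul,
    PowerSeries.coeff_succ_X_mul, PowerSeries.coeff_mk, map_zero] at h4
  linear_combination h4

end ODE

/-! ### The wave function and the quantum curve -/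

theorem expH_neg (c : ℂ) : expH (-c) = (expH c)⁻¹ := by
  have h1 := expH_add c (-c)
  rw [add_neg_cancel, expH_zero] at h1
  exact eq_inv_of_mul_eq_one_right h1.symm

theorem expH_half_pow (n : ℕ) : expH (1 / 2) ^ n = expH (n / 2) := by
  induction n with
  | zero => simp [expH_zero]
  | succ n ih =>
    rw [pow_succ, ih, ← expH_add]
    push_cast
    ring_nf

theorem expH_half_inv_pow (n : ℕ) : (expH (1 / 2))⁻¹ ^ n = expH (-n / 2) := by
  rw [inv_pow, expH_half_pow, ← expH_neg, neg_div]

theorem expH_sub_expH_neg_ne_zero {n : ℕ} (hn : 0 < n) :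
    expH ((n : ℂ) / 2) - expH (-(n : ℂ) / 2) ≠ 0 := by
  intro h
  have h1 := expH_injective (sub_eq_zero.1 h)
  have h2 : (n : ℂ) ≠ 0 := Nat.cast_ne_zero.2 hn.ne'
  exact h2 (by linear_combination h1)

theorem currentExp_pStar_succ (a : ℂ) (l : ℕ) :
    currentExp (plusOps (pStar a)) 1 (l + 1) *
        (expH (((l + 1 : ℕ) : ℂ) / 2) - expH (-((l + 1 : ℕ) : ℂ) / 2)) =
      currentExp (plusOps (pStar a)) 1 l *
        (const (Apow a 1) * expH ((l : ℂ) / 2) - const (Apow a (-1)) * expH (-(l : ℂ) / 2)) := by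
  have h := q_recursion (q := expH (1 / 2)) (c := const (Apow a 1)) (d := const (Apow a (-1)))
    (p := fun j => pStar a j.toPNat') (h := currentExp (plusOps (pStar a)) 1) ?_ ?_ l
  · simpa only [expH_half_pow, expH_half_inv_pow] using h
  · intro j hj
    rw [expH_half_pow, expH_half_inv_pow, pStar, PNat.toPNat'_coe hj, zetaH,
      div_mul_cancel₀ _ (expH_sub_expH_neg_ne_zero hj), const_eq, const_eq, const_eq, ← map_pow,
      ← map_pow, ← map_sub, ← Apow_natCast_mul, ← Apow_natCast_mul, mul_one, mul_neg_one]
  · intro l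
    have h1 := smul_currentExp (k := K) (T := plusOps (pStar a)) (fun i j _ _ v => by
      simp only [plusOps, LinearMap.smul_apply, LinearMap.id_apply, smul_eq_mul]
      ring) (1 : K) l
    exact h1

theorem negH_currentExp_pStar (a : ℂ) (l : ℕ) :
    negH (currentExp (plusOps (pStar a)) 1 l) = ∏ i ∈ Finset.Icc 1 l,
      (const (Apow a 1) * expH (-((i : ℂ) - 1) / 2) -
          const (Apow a (-1)) * expH (((i : ℂ) - 1) / 2)) /
        (expH (-(i : ℂ) / 2) - expH ((i : ℂ) / 2)) := by
  induction l with
  | zero => simp [currentExp_zero]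
  | succ l ih =>
    have h0 : expH (-((l + 1 : ℕ) : ℂ) / 2) - expH (((l + 1 : ℕ) : ℂ) / 2) ≠ 0 := by
      rw [← neg_sub]
      exact neg_ne_zero.2 (expH_sub_expH_neg_ne_zero l.succ_pos)
    have h := congrArg negH (currentExp_pStar_succ a l)
    simp only [map_mul, map_sub, negH_expH, negH_const, neg_div, neg_neg] at h
    simp only [neg_div] at h0
    rw [Finset.prod_Icc_succ_top (by omega), ← ih, ← mul_div_assoc, neg_div, neg_div, eq_div_iff h0,
      h]
    simp

theorem coeff_Psi_eq (P : ℤ) {Q : ℕ} (hQ : 0 < Q) (a : ℂ) (l : ℕ) :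
    PowerSeries.coeff l (Psi P Q a) = const (Apow a (l * slope P Q)) *
        expH (-(slope P Q : ℂ) * (((l : ℂ) ^ 2 - l) / 2)) *
        ∏ i ∈ Finset.Icc 1 l,
          (const (Apow a 1) * expH (-((i : ℂ) - 1) / 2) -
              const (Apow a (-1)) * expH (((i : ℂ) - 1) / 2)) /
            (expH (-(i : ℂ) / 2) - expH ((i : ℂ) / 2)) := by
  rw [coeff_Psi P hQ, map_mul, map_mul, negH_const, negH_expH, negH_currentExp_pStar, neg_mul,
    mul_assoc]

theorem coeff_expD_apply (c : ℂ) (f : PowerSeries K) (l : ℕ) :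
    PowerSeries.coeff l (expD c f) = expH (c * l) * PowerSeries.coeff l f := by
  simp [expD]

theorem coeff_succ_mulLam (f : PowerSeries K) (l : ℕ) :
    PowerSeries.coeff (l + 1) (mulLam f) = PowerSeries.coeff l f := by
  simp [mulLam, PowerSeries.coeff_succ_X_mul]

theorem coeff_zero_mulLam (f : PowerSeries K) : PowerSeries.coeff 0 (mulLam f) = 0 := by
  simp [mulLam]

/-- In degree `l + 1` the equation is the ratio of consecutive coefficients of `Ψ`; in degree `0`
the two shifts cancel. -/
theorem quantumCurve_Psi (P : ℤ) {Q : ℕ} (hQ : 0 < Q) (a : ℂ) :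
    quantumCurve P Q a (Psi P Q a) = 0 := by
  ext1 l
  rw [quantumCurve]
  simp only [LinearMap.sub_apply, Module.End.mul_apply, LinearMap.smul_apply, map_sub, map_zero,
    coeff_expD_apply]
  cases l with
  | zero => simp [coeff_zero_mulLam]
  | succ l =>
    simp only [coeff_succ_mulLam, map_smul, coeff_expD_apply, smul_eq_mul]
    rw [coeff_Psi_eq P hQ, coeff_Psi_eq P hQ, Finset.prod_Icc_succ_top (by omega)]
    have h0 : expH (-((l + 1 : ℕ) : ℂ) / 2) - expH (((l + 1 : ℕ) : ℂ) / 2) ≠ 0 := by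
      rw [← neg_sub]
      exact neg_ne_zero.2 (expH_sub_expH_neg_ne_zero l.succ_pos)
    have e1 : (-1 / 2 : ℂ) * ((l + 1 : ℕ) : ℂ) = -((l + 1 : ℕ) : ℂ) / 2 := by ring
    have e2 : (1 / 2 : ℂ) * ((l + 1 : ℕ) : ℂ) = ((l + 1 : ℕ) : ℂ) / 2 := by ring
    have e3 : -(((l + 1 : ℕ) : ℂ) - 1) / 2 = -1 / 2 * l := by push_cast; ring
    have e4 : (((l + 1 : ℕ) : ℂ) - 1) / 2 = 1 / 2 * l := by push_cast; ring
    -- The `F₂` eigenvalue grows by `l` from row `l` to row `l + 1`, which accounts for the factor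
    -- `e^{-ħbD}`.
    have e5 : expH (-(slope P Q : ℂ) * ((((l + 1 : ℕ) : ℂ) ^ 2 - (l + 1 : ℕ)) / 2)) =
        expH (-(slope P Q : ℂ) * l) * expH (-(slope P Q : ℂ) * (((l : ℂ) ^ 2 - l) / 2)) := by
      rw [← expH_add]
      congr 1
      push_cast
      ring
    have e6 : const (Apow a ((l + 1 : ℕ) * slope P Q)) =
        const (Apow a (slope P Q)) * const (Apow a (l * slope P Q)) := by
      rw [Apow_natCast_mul, Apow_natCast_mul, pow_succ', const_eq, const_eq, const_eq, map_mul]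
    rw [e1, e2, e3, e4, e5, e6, ← sub_mul]
    generalize expH (-((l + 1 : ℕ) : ℂ) / 2) - expH (((l + 1 : ℕ) : ℂ) / 2) = r at h0 ⊢
    field_simp
    ring

/-! ### Dequantization -/

theorem expD_mul (c d : ℂ) : expD c * expD d = expD (c + d) := by
  refine LinearMap.ext fun f => ?_
  ext1 l
  rw [Module.End.mul_apply, coeff_expD_apply, coeff_expD_apply, coeff_expD_apply, ← mul_assoc,
    ← expH_add, add_mul]

namespace DiffExpr

theorem toOp_single (j : ℕ) (r : ℚ) (c : ℂ) :
    toOp (Finsupp.single (j, r) c) = const c • (mulLam ^ j * expD (r : ℂ)) :=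
  Finsupp.sum_single_index (by rw [const_eq, map_zero, zero_smul])

theorem toOp_add (S T : DiffExpr) : toOp (S + T) = toOp S + toOp T :=
  Finsupp.sum_add_index' (fun _ => by rw [const_eq, map_zero, zero_smul])
    (fun _ _ _ => by rw [const_eq, map_add, add_smul]; rfl)

theorem toOp_sub (S T : DiffExpr) : toOp (S - T) = toOp S - toOp T := by
  rw [eq_sub_iff_add_eq, ← toOp_add, sub_add_cancel]

theorem symbol_single (j : ℕ) (r : ℚ) (c lam v : ℂ) :
    symbol (Finsupp.single (j, r) c) lam v = c * Complex.exp (j * lam) * Complex.exp (r * v) :=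
  Finsupp.sum_single_index (by simp)

theorem symbol_add (S T : DiffExpr) (lam v : ℂ) :
    symbol (S + T) lam v = symbol S lam v + symbol T lam v :=
  Finsupp.sum_add_index' (fun _ => by simp) (fun _ _ _ => by ring)

theorem coeff_mulLam_pow (i j l : ℕ) (c : K) :
    PowerSeries.coeff (l + j) ((mulLam ^ i) (PowerSeries.C c * PowerSeries.X ^ l)) =
      if i = j then c else 0 := by
  have h : (mulLam ^ i) (PowerSeries.C c * PowerSeries.X ^ l) =
      PowerSeries.C c * PowerSeries.X ^ (l + i) := by
    rw [mulLam, LinearMap.pow_mulLeft, LinearMap.mulLeft_apply, pow_add]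
    ring
  rw [h, PowerSeries.coeff_C_mul, PowerSeries.coeff_X_pow]
  by_cases h : i = j
  · simp [h]
  · simp [h, Ne.symm h]

theorem expD_X_pow (c : ℂ) (l : ℕ) :
    expD c (PowerSeries.X ^ l) = PowerSeries.C (expH (c * l)) * PowerSeries.X ^ l := by
  ext1 n
  rw [coeff_expD_apply, PowerSeries.coeff_C_mul, PowerSeries.coeff_X_pow]
  split_ifs with h
  · rw [h]
  · simp

/-- Raising the degree by `j` isolates the part of order `j` in `Λ`, leaving an exponential sum in
`l`. -/
theorem coeff_toOp_X_pow (S : DiffExpr) (j l : ℕ) :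
    PowerSeries.coeff (l + j) (S.toOp (PowerSeries.X ^ l)) =
      ∑ r ∈ S.support.image Prod.snd, const (S (j, r)) * expH (r * l) := by
  have h1 : PowerSeries.coeff (l + j) (S.toOp (PowerSeries.X ^ l)) =
      S.sum fun x c => if x.1 = j then const c * expH (x.2 * l) else 0 := by
    rw [toOp, Finsupp.sum, LinearMap.sum_apply, map_sum]
    refine Finset.sum_congr rfl fun x _ => ?_
    rw [LinearMap.smul_apply, Module.End.mul_apply, expD_X_pow, map_smul, coeff_mulLam_pow,
      smul_eq_mul, mul_ite, mul_zero]
  -- Inserting `j` covers the case where no term of order `j` occurs.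
  have h2 : S.support ⊆ insert j (S.support.image Prod.fst) ×ˢ S.support.image Prod.snd := by
    intro x hx
    rw [Finset.mem_product]
    exact ⟨Finset.mem_insert_of_mem (Finset.mem_image_of_mem _ hx), Finset.mem_image_of_mem _ hx⟩
  rw [h1, Finsupp.sum_of_support_subset _ h2, Finset.sum_product_right]
  · refine Finset.sum_congr rfl fun r _ => ?_
    rw [Finset.sum_ite_eq', if_pos (Finset.mem_insert_self _ _)]
  · intro x _
    rw [const_eq, map_zero, zero_mul, ite_self]

/-- Independence of characters of the monoid `ℕ`; they are distinct because `expH` is injective. -/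
theorem linearIndependent_expH_pow :
    LinearIndependent K fun (r : ℚ) (l : Multiplicative ℕ) => powersHom K (expH r) l := by
  have h := (linearIndependent_monoidHom (Multiplicative ℕ) K).comp
    (fun r : ℚ => powersHom K (expH r)) ?_
  · exact h
  · intro r s hrs
    exact_mod_cast expH_injective ((powersHom K).injective hrs)

theorem expH_pow (c : ℂ) (l : ℕ) : expH c ^ l = expH (c * l) := by
  induction l with
  | zero => simp [expH_zero]
  | succ l ih => rw [pow_succ, ih, ← expH_add]; push_cast; ring_nf

theorem eq_zero_of_toOp_eq_zero {S : DiffExpr} (h : S.toOp = 0) : S = 0 := by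
  ext ⟨j, r⟩
  rw [Finsupp.zero_apply]
  by_contra hS
  have h1 := linearIndependent_iff'.1 linearIndependent_expH_pow (S.support.image Prod.snd)
    (fun r => const (S (j, r))) ?_ r
    (Finset.mem_image_of_mem _ (Finsupp.mem_support_iff.2 hS : (j, r) ∈ S.support))
  · exact hS ((map_eq_zero constHom).1 h1)
  · funext l
    have h2 := coeff_toOp_X_pow S j l.toAdd
    rw [h, LinearMap.zero_apply, map_zero] at h2
    rw [Finset.sum_apply, Pi.zero_apply, h2]
    refine Finset.sum_congr rfl fun r _ => ?_
    rw [Pi.smul_apply, smul_eq_mul, powersHom_apply, expH_pow]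

theorem toOp_injective : Function.Injective toOp := fun S T h =>
  sub_eq_zero.1 (eq_zero_of_toOp_eq_zero (by rw [toOp_sub, h, sub_self]))

end DiffExpr

/-- The normally ordered expression of the quantum curve. -/
def curveExpr (P : ℤ) (Q : ℕ) (a : ℂ) : DiffExpr :=
  Finsupp.single (0, -1 / 2) 1 + Finsupp.single (0, 1 / 2) (-1) +
    Finsupp.single (1, -slope P Q + -1 / 2) (-(Apow a (slope P Q) * Apow a 1)) +
    Finsupp.single (1, -slope P Q + 1 / 2) (Apow a (slope P Q) * Apow a (-1))

theorem toOp_curveExpr (P : ℤ) (Q : ℕ) (a : ℂ) : (curveExpr P Q a).toOp = quantumCurve P Q a := by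
  simp only [curveExpr, DiffExpr.toOp_add, DiffExpr.toOp_single, quantumCurve]
  push_cast
  rw [← expD_mul, ← expD_mul]
  refine LinearMap.ext fun f => ?_
  ext1 l
  simp only [const_eq, map_neg, map_mul, map_one, LinearMap.sub_apply, LinearMap.add_apply,
    LinearMap.smul_apply, Module.End.mul_apply, pow_zero, pow_one, Module.End.one_apply, map_sub,
    map_add, map_smul, smul_eq_mul]
  cases l with
  | zero =>
    simp only [coeff_zero_mulLam]
    ring
  | succ l =>
    simp only [coeff_succ_mulLam]
    ring

theorem symbol_curveExpr (P : ℤ) (Q : ℕ) (a lam v : ℂ) :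
    (curveExpr P Q a).symbol lam v = Complex.exp (-v / 2) * ((1 - Complex.exp v) -
      Complex.exp lam * (Apow a (slope P Q + 1) * Complex.exp (-(slope P Q : ℂ) * v) *
        (1 - Apow a (-2) * Complex.exp v))) := by
  have h1 : Complex.exp ((1 / 2 : ℂ) * v) = Complex.exp (-v / 2) * Complex.exp v := by
    rw [← Complex.exp_add]; ring_nf
  have h2 : Complex.exp ((-1 / 2 : ℂ) * v) = Complex.exp (-v / 2) := by ring_nf
  have h3 : Apow a (-1) = Apow a 1 * Apow a (-2) := by rw [← Apow_add]; norm_num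
  simp only [curveExpr, DiffExpr.symbol_add, DiffExpr.symbol_single]
  push_cast
  rw [add_mul, add_mul, Complex.exp_add, Complex.exp_add, h1, h2, h3, Apow_add]
  simp only [zero_mul, one_mul, Complex.exp_zero]
  ring

theorem isDequantization_iff (P : ℤ) (Q : ℕ) (a : ℂ) (σ : ℂ → ℂ → ℂ) :
    IsDequantization (quantumCurve P Q a) σ ↔ σ = (curveExpr P Q a).symbol := by
  constructor
  · rintro ⟨S, hS, rfl⟩
    rw [DiffExpr.toOp_injective (hS.trans (toOp_curveExpr P Q a).symm)]
  · rintro rfl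
    exact ⟨_, toOp_curveExpr P Q a, rfl⟩

theorem Apow_neg_two_ne_one {a : ℂ} (ha : Complex.exp a ^ 2 ≠ 1) : Apow a (-2) ≠ 1 := by
  intro h
  apply ha
  have h1 : Apow a (-2) * Complex.exp a ^ 2 = 1 := by
    rw [Apow, ← Complex.exp_nat_mul, ← Complex.exp_add]
    simp
  rwa [h, one_mul] at h1

theorem symbol_curveExpr_eq_zero_iff (P : ℤ) (Q : ℕ) (a lam v : ℂ) :
    (curveExpr P Q a).symbol lam v = 0 ↔
      Complex.exp lam * (Apow a (slope P Q + 1) * Complex.exp (-(slope P Q : ℂ) * v) *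
        (1 - Apow a (-2) * Complex.exp v)) = 1 - Complex.exp v := by
  rw [symbol_curveExpr, mul_eq_zero, or_iff_right (Complex.exp_ne_zero _), sub_eq_zero, eq_comm]

/-- If `1 - A⁻²V = 0`, vanishing of the symbol would force `V = 1`, hence `A² = 1`. -/
theorem symbol_curveExpr_eq_zero_iff_eq_div (P : ℤ) (Q : ℕ) {a : ℂ}
    (ha : Complex.exp a ^ 2 ≠ 1) (lam v : ℂ) :
    (curveExpr P Q a).symbol lam v = 0 ↔ 1 - Apow a (-2) * Complex.exp v ≠ 0 ∧
      Complex.exp lam = (1 - Complex.exp v) /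
        (Apow a (slope P Q + 1) * Complex.exp (-(slope P Q : ℂ) * v) *
          (1 - Apow a (-2) * Complex.exp v)) := by
  rw [symbol_curveExpr_eq_zero_iff]
  by_cases h : 1 - Apow a (-2) * Complex.exp v = 0
  · simp only [h, ne_eq, not_true_eq_false, false_and, mul_zero, iff_false]
    intro h1
    rw [← sub_eq_zero.1 h1.symm, mul_one, sub_eq_zero] at h
    exact Apow_neg_two_ne_one ha h.symm
  · rw [eq_div_iff (mul_ne_zero (mul_ne_zero (Apow_ne_zero _ _) (Complex.exp_ne_zero _)) h)]
    exact ⟨fun h1 => ⟨h, h1⟩, fun h1 => h1.2⟩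

/-- On the curve `v = lp - lm` and `l = λ - bv`, so `U = ΛV^{-b}` and the symbol equation reads `V
(1 - A^{b-1}U) = 1 - A^{b+1}U`. -/
theorem mem_BEMCurve_iff (P : ℤ) {Q : ℕ} (hQ : 0 < Q) {a : ℂ} (ha : Complex.exp a ^ 2 ≠ 1)
    (γ : ℤ) (x y : ℂ) : (x, y) ∈ BEMCurve P Q a γ ↔
      (curveExpr P Q a).symbol (x / Q) (Q * y - γ * x) = 0 := by
  have hQ' : (Q : ℂ) ≠ 0 := Nat.cast_ne_zero.2 hQ.ne'
  have hb : (slope P Q : ℂ) = P / Q := by simp [slope]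
  have hA : Apow a (slope P Q - 1) = Apow a (slope P Q + 1) * Apow a (-2) := by
    rw [← Apow_add]; ring_nf
  rw [symbol_curveExpr_eq_zero_iff]
  set v : ℂ := Q * y - γ * x with hv
  have key : ∀ U : ℂ, U = Complex.exp (x / Q) * Complex.exp (-(slope P Q : ℂ) * v) →
      (Complex.exp (x / Q) * (Apow a (slope P Q + 1) * Complex.exp (-(slope P Q : ℂ) * v) *
        (1 - Apow a (-2) * Complex.exp v)) = 1 - Complex.exp v ↔
      Complex.exp v * (1 - Apow a (slope P Q - 1) * U) = 1 - Apow a (slope P Q + 1) * U) := by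
    rintro U rfl
    rw [hA]
    constructor <;> intro h <;> linear_combination h
  constructor
  · rintro ⟨U, l, lp, lm, hl, hlp, hlm, hx, hy⟩
    dsimp only at hx hy
    have hvl : v = lp - lm := by
      rw [hv, hy]
      field_simp
      ring
    have hxl : x / Q + -(slope P Q : ℂ) * v = l := by
      rw [hvl, hx, hb]
      field_simp
      ring
    rw [key U (by rw [← Complex.exp_add, hxl, hl]), ← hlm, ← hlp, ← Complex.exp_add, hvl,
      sub_add_cancel]
  · intro h
    rw [key _ rfl] at h
    rw [← Complex.exp_add] at h
    -- If this factor vanished, so would `1 - A^{b+1}U`, giving `A² = 1`.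
    have h0 : 1 - Apow a (slope P Q - 1) * Complex.exp (x / Q + -(slope P Q : ℂ) * v) ≠ 0 := by
      intro h0
      rw [h0, mul_zero, eq_comm, sub_eq_zero] at h
      rw [hA, mul_right_comm, ← h, one_mul, sub_eq_zero] at h0
      exact Apow_neg_two_ne_one ha h0.symm
    -- Any branch serves for `lm`, here the principal one; `lp = v + lm` is then forced.
    refine ⟨_, x / Q + -(slope P Q : ℂ) * v, v + Complex.log
      (1 - Apow a (slope P Q - 1) * Complex.exp (x / Q + -(slope P Q : ℂ) * v)), _, rfl, ?_,
      Complex.exp_log h0, ?_, ?_⟩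
    · rw [Complex.exp_add, Complex.exp_log h0, h]
    · dsimp only
      rw [hb]
      field_simp
      ring
    · dsimp only
      rw [hv]
      field_simp
      ring

end TorusQSC

end

theorem theorem10p1 (P : ℤ) (Q : ℕ) (hQ : 0 < Q) (a : ℂ) :
    (∀ l : ℕ, PowerSeries.coeff l (TorusQSC.Psi P Q a) =
      TorusQSC.const (TorusQSC.Apow a (l * TorusQSC.slope P Q)) *
        TorusQSC.expH (-(TorusQSC.slope P Q : ℂ) * (((l : ℂ) ^ 2 - l) / 2)) *
        ∏ i ∈ Finset.Icc 1 l,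
          (TorusQSC.const (TorusQSC.Apow a 1) * TorusQSC.expH (-((i : ℂ) - 1) / 2) -
              TorusQSC.const (TorusQSC.Apow a (-1)) * TorusQSC.expH (((i : ℂ) - 1) / 2)) /
            (TorusQSC.expH (-(i : ℂ) / 2) - TorusQSC.expH ((i : ℂ) / 2))) ∧
    TorusQSC.quantumCurve P Q a (TorusQSC.Psi P Q a) = 0 ∧
    (∃! σ : ℂ → ℂ → ℂ, TorusQSC.IsDequantization (TorusQSC.quantumCurve P Q a) σ) ∧
    (Complex.exp a ^ 2 ≠ 1 →
      ∀ σ : ℂ → ℂ → ℂ, TorusQSC.IsDequantization (TorusQSC.quantumCurve P Q a) σ →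
        (∀ lam v : ℂ, σ lam v = 0 ↔
          1 - TorusQSC.Apow a (-2) * Complex.exp v ≠ 0 ∧
          Complex.exp lam = (1 - Complex.exp v) /
            (TorusQSC.Apow a (TorusQSC.slope P Q + 1) *
              Complex.exp (-(TorusQSC.slope P Q : ℂ) * v) *
              (1 - TorusQSC.Apow a (-2) * Complex.exp v))) ∧
        (∀ γ δ : ℤ, (Q : ℤ) * δ - P * γ = 1 → ∀ x y : ℂ,
          (x, y) ∈ TorusQSC.BEMCurve P Q a γ ↔ σ (x / Q) (Q * y - γ * x) = 0)) := by
  refine ⟨TorusQSC.coeff_Psi_eq P hQ a, TorusQSC.quantumCurve_Psi P hQ a,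
    ⟨_, (TorusQSC.isDequantization_iff P Q a _).2 rfl,
      fun σ hσ => (TorusQSC.isDequantization_iff P Q a σ).1 hσ⟩, fun ha σ hσ => ?_⟩
  obtain rfl := (TorusQSC.isDequantization_iff P Q a σ).1 hσ
  exact ⟨TorusQSC.symbol_curveExpr_eq_zero_iff_eq_div P Q ha,
    fun γ _ _ => TorusQSC.mem_BEMCurve_iff P hQ ha γ⟩
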